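/- **Notation.** Let $\mathbb S=\{I\in\mathbb H: I^2=-1\}$ and, for $z=\alpha+i\beta\in\mathbb C$, $\mathbb S_z=\{\alpha+\beta I: I\in\mathbb S\}$. For $D\subseteq\mathbb C$ let $\Omega_D=\bigcup_{z\in D}\mathbb S_z$. On an open set $U\subseteq \mathbb C$ symmetric with respect to the real axis, a holomorphic stem function is a holomorphic map $F=F_1+F_2\imath:U\to\mathbb H\otimes_{\mathbb R}\mathbb C$ with $F(\bar z)=\overline{F(z)}$; it induces the slice regular function $f(\alpha+\beta I)=F_1(\alpha+i\beta)+I\,F_2(\alpha+i\beta)$ on $\Omega_U$. The slice product $f*g$ is induced by $FG$; $f^c$ is induced by $F^c=F_1^c+F_2^c\imath$ (quaternionic conjugation); $g^{-*}$ is induced by $(G^cG)^{-1}G^c$. A function $f:\Omega_D\to\mathbb H\cup\{\infty\}$ is semi-regular if near each sphere $\mathbb S_z$, $z\in D$, it is, off $\mathbb S_z$, a slice quotient $g^{-*}*h$ of slice regular functions $g,h$ such that $G^cG$ has no zeros other than possibly $z,\bar z$, and if at each $q\in\mathbb S_z$ the value $f(q)$ is the limit of $f(x)$ in $\mathbb H\cup\{\infty\}$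 as $x\to q$, $x\notin\mathbb S_z$, whenever this limit exists. *Divisor.* A slice regular function $h$ has multiplicity $m_z(h)=m$ at $z$ if near $\mathbb S_z$ one has $h=(q-a_1)*\cdots*(q-a_m)*g$ with $a_i\in\mathbb S_z$ and $g$ slice regular without zeros on $\mathbb S_z$. For $f=g^{-*}*h$ near $\mathbb S_z$ put $m_z(f)=m_z(h)-m_z(g)$; the divisor $\mathrm{div}(f)=\sum m_k\{p_k\}$ is the formal sum of the points $p_k\in D$ with $\operatorname{Im}p_k\ge 0$ with coefficients $m_k=m_{p_k}(f)$. *Zeros and poles.* At a real point $x$ one has $f=(q-x)^k g$ near $x$ with $k\in\mathbb Z$ and $g$ slice regular, $g(x)\ne0$; $x$ is a (punctual) real zero of multiplicity $k$ if $k>0$ and a real pole of multiplicity $-k$ if $k<0$. Near a non-real sphere $\mathbb S_z$, $z=\alpha+i\beta$, one has $f=((q-\alpha)^2+\beta^2)^m\,(q-p_1)*\cdots*(q-p_n)*g$ with $m\in\mathbb Z$, $n\ge0$, $p_i\in\mathbb S_z$, $p_{i+1}\neq\bar p_i$, and $g$ slice regular without zeros on $\mathbb S_z$; $\mathbb S_z$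 is a spherical zero of multiplicity $m$ if $m>0$, a spherical pole of multiplicity $-m$ if $m<0$, and $p_1$ is a punctual zero of multiplicity $n$ if $n>0$. **Proposition (Jensen's Formula).** Let $D\subseteq\mathbb C$ be a domain symmetric with respect to the real axis, let $f:\Omega_D\to\mathbb H\cup\{\infty\}$ be semi-regular, and let $\rho>0$ be such that $\overline{\mathbb B_\rho}=\{q\in\mathbb H:|q|\le\rho\}\subset\Omega_D$, $f(0)\ne0,\infty$, and $f(y)\neq0,\infty$ for every $y\in\partial\mathbb B_\rho$. Let $\mu$ be a (Borel) probability measure on $\mathbb S$. Put $$A=\frac1{2\pi}\int_0^{2\pi}\int_{\mathbb S}\log|f(\rho\cos\theta+\rho\sin\theta\, I)|\,d\mu(I)\,d\theta ,$$ where the integrand is integrable with respect to $d\theta\otimes\mu$. 1. Let $\{r_k\}$ be the punctual zeros of $f$ (real or not), $\{w_n\}$ the real poles, $\{\mathbb S_{a_i}\}$ the spherical zeros and $\{\mathbb S_{b_j}\}$ the spherical poles, each repeated according to its multiplicity. Only finitely many of them lie in $\mathbb B_\rho$, and $$\log|f(0)|\le A-\sum_{|r_k|<\rho}\log\frac{\rho}{|r_k|}+\sum_{|w_n|<\rho}\log\frac{\rho}{|w_n|}-2\sum_{|a_i|<\rho}\log\frac{\rho}{|a_i|}+2\sum_{|b_j|<\rho}\log\frac{\rho}{|b_j|}.$$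 2. If $\mathrm{div}(f)=\sum m_k\{p_k\}$, then only finitely many $k$ with $|p_k|<\rho$ have $m_k\ne0$, and $$\log|f(0)|\le A-\sum_{|p_k|<\rho}m_k\log\frac{\rho}{|p_k|}.$$ -/

import Mathlib

open scoped Quaternion ComplexConjugate

noncomputable section

/-! ### Quaternions, imaginary units, circular sets -/

/-- The sphere `𝕊` of imaginary units of `ℍ`. -/
def imUnits : Set ℍ := {I : ℍ | I * I = -1}

/-- The Borel σ-algebra on the sphere of imaginary units. -/
instance imUnitsMeasurableSpace : MeasurableSpace imUnits := borel imUnits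

/-- The quaternion `α + β I`, where `z = α + i β`. -/
def slicePoint (z : ℂ) (I : ℍ) : ℍ := (z.re : ℍ) + z.im • I

/-- The sphere `𝕊_{α + β I} = {α + β J : J ∈ 𝕊}`, where `z = α + i β`
(a single point if `β = 0`). -/
def sphereOf (z : ℂ) : Set ℍ := {q : ℍ | ∃ I ∈ imUnits, q = slicePoint z I}

/-- The circularization `Ω_D` of `D ⊆ ℂ`. -/
def circularization (D : Set ℂ) : Set ℍ :=
  {q : ℍ | ∃ z ∈ D, ∃ I ∈ imUnits, q = slicePoint z I}

/-- Symmetry of a subset of `ℂ` with respect to the real axis. -/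
def IsSymmetricSet (D : Set ℂ) : Prop := ∀ z ∈ D, conj z ∈ D

/-- An open symmetric neighbourhood of `z` in `ℂ`. -/
def IsSymmNhd (U : Set ℂ) (z : ℂ) : Prop := IsOpen U ∧ IsSymmetricSet U ∧ z ∈ U

/-! ### Stem functions

The complexification `ℍ ⊗ ℂ` is the algebra `ℍ[ℂ]` of quaternions with complex coefficients.
Its `star` is the `ℂ`-linear quaternionic conjugation `(p + q ι)ᶜ = pᶜ + qᶜ ι`, its central
scalars are `ℂ`, and `Quaternion.normSq x = xᶜ x`. -/

/-- The component `p` of `p + q ι`, with `p q : ℍ`. -/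
def stemRe (x : ℍ[ℂ]) : ℍ := ⟨x.re.re, x.imI.re, x.imJ.re, x.imK.re⟩

/-- The component `q` of `p + q ι`, with `p q : ℍ`. -/
def stemIm (x : ℍ[ℂ]) : ℍ := ⟨x.re.im, x.imI.im, x.imJ.im, x.imK.im⟩

/-- The complex conjugation `p + q ι ↦ p - q ι`. -/
def complexConj (x : ℍ[ℂ]) : ℍ[ℂ] := ⟨conj x.re, conj x.imI, conj x.imJ, conj x.imK⟩

/-- The embedding `ℍ → ℍ ⊗ ℂ`, `a ↦ a + 0 ι`. -/
def toComplexified (a : ℍ) : ℍ[ℂ] := ⟨(a.re : ℂ), (a.imI : ℂ), (a.imJ : ℂ), (a.imK : ℂ)⟩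

/-- The value `p + I q` at an imaginary unit `I` of the element `p + q ι`. -/
def evalAt (x : ℍ[ℂ]) (I : ℍ) : ℍ := stemRe x + I * stemIm x

/-- `F` is a holomorphic stem function on the (open, symmetric) set `U`. -/
structure IsHolStem (U : Set ℂ) (F : ℂ → ℍ[ℂ]) : Prop where
  stem : ∀ w ∈ U, F (conj w) = complexConj (F w)
  diff_re : DifferentiableOn ℂ (fun w => (F w).re) U
  diff_imI : DifferentiableOn ℂ (fun w => (F w).imI) U
  diff_imJ : DifferentiableOn ℂ (fun w => (F w).imJ) U
  diff_imK : DifferentiableOn ℂ (fun w => (F w).imK) U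

/-- On `Ω_U`, the function `f` is finite and it is the slice function induced by `F`:
`f (α + β I) = F₁ (α + i β) + I F₂ (α + i β)`. -/
def InducedOn (U : Set ℂ) (F : ℂ → ℍ[ℂ]) (f : ℍ → OnePoint ℍ) : Prop :=
  ∀ w ∈ U, ∀ I ∈ imUnits, f (slicePoint w I) = ((evalAt (F w) I : ℍ) : OnePoint ℍ)

/-- The slice function induced by `F` has no zero on the sphere `𝕊_z`. -/
def NonvanishingOnSphere (F : ℂ → ℍ[ℂ]) (z : ℂ) : Prop :=
  ∀ I ∈ imUnits, evalAt (F z) I ≠ 0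

/-- The stem function of the slice regular function `q ↦ q - a`. -/
def linearStem (a : ℍ) (w : ℂ) : ℍ[ℂ] := algebraMap ℂ ℍ[ℂ] w - toComplexified a

/-- The stem function of the slice product `(q - a₁) * ⋯ * (q - aₙ)`. -/
def linearStemProd (l : List ℍ) (w : ℂ) : ℍ[ℂ] := (l.map fun a => linearStem a w).prod

/-- The stem function of the slice quotient `g^{-*} * h`, i.e. `(Gᶜ G)⁻¹ Gᶜ H`. -/
def quotientStem (G H : ℂ → ℍ[ℂ]) (w : ℂ) : ℍ[ℂ] :=
  (Quaternion.normSq (G w))⁻¹ • (star (G w) * H w)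

/-! ### Semi-regular functions -/

/-- On `Ω_U`, where `U` is a symmetric neighbourhood of `z`, the function `f` is the slice quotient
`g^{-*} * h` of the slice regular functions with stem functions `G` and `H`, where the
symmetrization of `g` has no zero outside the sphere `𝕊_z`. (The zeros of a symmetrization that is
not locally identically zero are isolated in `U`, so the last condition is a matter of shrinking
`U`.) -/
structure IsLocalQuotient (f : ℍ → OnePoint ℍ) (z : ℂ) (U : Set ℂ) (G H : ℂ → ℍ[ℂ]) : Prop where
  nhd : IsSymmNhd U z
  hol_den : IsHolStem U G
  hol_num : IsHolStem U H
  den_ne_zero : ∀ w ∈ U \ {z, conj z}, Quaternion.normSq (G w) ≠ 0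
  induced : InducedOn (U \ {z, conj z}) (quotientStem G H) f

/-- `f : Ω_D → ℍ ∪ {∞}` is semi-regular: locally it is a slice quotient `g^{-*} * h` of slice
regular functions, and at each point `q` the value `f q` is the limit in `ℍ ∪ {∞}` of `f x` as
`x → q` outside the sphere through `q`, whenever this limit exists. So `f` takes the regular
values at removable singularities and the value `∞` wherever `|f x| → ∞`. -/
structure IsSemiRegular (D : Set ℂ) (f : ℍ → OnePoint ℍ) : Prop where
  local_quotient : ∀ z ∈ D, ∃ U ⊆ D, ∃ G H : ℂ → ℍ[ℂ], IsLocalQuotient f z U G H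
  value_eq_limit : ∀ z ∈ D, ∀ q ∈ sphereOf z, ∀ v : OnePoint ℍ,
    Filter.Tendsto f (nhdsWithin q (sphereOf z)ᶜ) (nhds v) → f q = v

/-- The absolute value of a finite value of a semi-regular function. -/
def finiteAbs (v : OnePoint ℍ) : ℝ := v.elim 0 (fun q => ‖q‖)

/-! ### The slice divisor -/

/-- The number singled out by the property `P`, and `0` if no number has the property `P`. -/
def numberWith {α : Type} [Zero α] (P : α → Prop) : α :=
  open Classical in if h : ∃ a, P a then h.choose else 0

/-- The slice regular function `f` with stem function `F` has multiplicity `m` at `z`: near the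
sphere `𝕊_z` one has `f = (q - a₁) * ⋯ * (q - aₘ) * g` with `aᵢ ∈ 𝕊_z` and `g` slice regular
without zeros on `𝕊_z`. -/
def HasMultiplicity (F : ℂ → ℍ[ℂ]) (z : ℂ) (m : ℕ) : Prop :=
  ∃ (U : Set ℂ) (l : List ℍ) (K : ℂ → ℍ[ℂ]), IsSymmNhd U z ∧ l.length = m ∧
    (∀ a ∈ l, a ∈ sphereOf z) ∧ IsHolStem U K ∧ NonvanishingOnSphere K z ∧
    ∀ w ∈ U, F w = linearStemProd l w * K w

/-- The semi-regular function `f` has multiplicity `k` at `z`: locally `f = g^{-*} * h`, and `k`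
is the multiplicity of `h` minus the multiplicity of `g`. -/
def HasSliceDivisorAt (f : ℍ → OnePoint ℍ) (z : ℂ) (k : ℤ) : Prop :=
  ∃ (U : Set ℂ) (G H : ℂ → ℍ[ℂ]) (m n : ℕ), IsLocalQuotient f z U G H ∧
    HasMultiplicity H z m ∧ HasMultiplicity G z n ∧ k = (m : ℤ) - (n : ℤ)

/-- The coefficient at `z` (in the closed upper half plane) of the slice divisor of `f`. -/
def sliceDivisor (f : ℍ → OnePoint ℍ) (z : ℂ) : ℤ := numberWith (HasSliceDivisorAt f z)

/-- The points of the closed upper half plane of modulus less than `ρ`. -/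
def closedUpperHalfDisc (ρ : ℝ) : Set ℂ := {z : ℂ | 0 ≤ z.im ∧ ‖z‖ < ρ}

/-! ### Real, punctual and spherical zeros and poles -/

/-- `f` has order `k` at the real point `x`: near `x` one has `f = (q - x)^k g` with `g` slice
regular and `g x ≠ 0`. -/
def HasRealOrder (f : ℍ → OnePoint ℍ) (x : ℝ) (k : ℤ) : Prop :=
  ∃ (U : Set ℂ) (K : ℂ → ℍ[ℂ]), IsSymmNhd U (x : ℂ) ∧ IsHolStem U K ∧
    NonvanishingOnSphere K (x : ℂ) ∧
    InducedOn (U \ {(x : ℂ)}) (fun w => ((w - (x : ℂ)) ^ k) • K w) f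

/-- Near the sphere `𝕊_z`, with `z = α + i β` not real, one has
`f = ((q - α)² + β²)^m (q - p₁) * ⋯ * (q - pₙ) * g` with `pᵢ ∈ 𝕊_z`, no `p_{i+1}` being the
conjugate of `pᵢ`, and with `g` slice regular without zeros on `𝕊_z`. The exponent `m : ℤ` is
the spherical multiplicity and `n` is the multiplicity of `p₁` as a punctual zero. -/
def HasSphericalForm (f : ℍ → OnePoint ℍ) (z : ℂ) (m : ℤ) (l : List ℍ) : Prop :=
  ∃ (U : Set ℂ) (K : ℂ → ℍ[ℂ]), IsSymmNhd U z ∧ IsHolStem U K ∧ NonvanishingOnSphere K z ∧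
    (∀ p ∈ l, p ∈ sphereOf z) ∧ l.IsChain (fun p p' => p' ≠ star p) ∧
    InducedOn (U \ {z, conj z})
      (fun w => (((w - (z.re : ℂ)) ^ 2 + (z.im : ℂ) ^ 2) ^ m) • (linearStemProd l w * K w)) f

/-- The punctual zero `p` (real or not) of `f` has multiplicity `n`. -/
def HasPunctualZeroMultiplicity (f : ℍ → OnePoint ℍ) (p : ℍ) (n : ℕ) : Prop :=
  (∃ (x : ℝ) (k : ℤ), p = (x : ℍ) ∧ HasRealOrder f x k ∧ n = k.toNat) ∨
  (∃ (z : ℂ) (m : ℤ) (l : List ℍ), 0 < z.im ∧ HasSphericalForm f z m l ∧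
    l.head? = some p ∧ n = l.length)

/-- Multiplicity of `p` as a punctual zero of `f` (`0` if it is none). -/
def punctualZeroMult (f : ℍ → OnePoint ℍ) (p : ℍ) : ℕ :=
  numberWith (HasPunctualZeroMultiplicity f p)

/-- Multiplicity of the real point `x` as a pole of `f` (`0` if it is none). -/
def realPoleMult (f : ℍ → OnePoint ℍ) (x : ℝ) : ℕ :=
  numberWith fun n : ℕ => ∃ k : ℤ, HasRealOrder f x k ∧ n = (-k).toNat

/-- Multiplicity of `𝕊_z` as a spherical zero of `f` (`0` if it is none), for `z` not real. -/
def sphericalZeroMult (f : ℍ → OnePoint ℍ) (z : ℂ) : ℕ :=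
  numberWith fun n : ℕ => ∃ (m : ℤ) (l : List ℍ), HasSphericalForm f z m l ∧ n = m.toNat

/-- Multiplicity of `𝕊_z` as a spherical pole of `f` (`0` if it is none), for `z` not real. -/
def sphericalPoleMult (f : ℍ → OnePoint ℍ) (z : ℂ) : ℕ :=
  numberWith fun n : ℕ => ∃ (m : ℤ) (l : List ℍ), HasSphericalForm f z m l ∧ n = (-m).toNat

/-- The points of the open upper half plane of modulus less than `ρ`; they parametrize the
spheres `𝕊_z` in the ball of radius `ρ` that are not a real point. -/
def openUpperHalfDisc (ρ : ℝ) : Set ℂ := {z : ℂ | 0 < z.im ∧ ‖z‖ < ρ}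

/-! ### The boundary mean -/

/-- The mean `(1 / 2π) ∫₀^{2π} ∫_𝕊 log |f (ρ cos θ + ρ sin θ I)| dμ(I) dθ`. -/
def boundaryLogMean (f : ℍ → OnePoint ℍ) (ρ : ℝ) (μ : MeasureTheory.Measure imUnits) : ℝ :=
  (1 / (2 * Real.pi)) * ∫ θ in (0 : ℝ)..(2 * Real.pi), ∫ I : imUnits,
    Real.log (finiteAbs (f (((ρ * Real.cos θ : ℝ) : ℍ) + (ρ * Real.sin θ) • (I : ℍ)))) ∂μ

end

noncomputable section

/-! ### Algebra of imaginary units and stem values -/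

/-! The inequality is the classical Jensen formula for one complex meromorphic function, the
symmetrization `N = Fᶜ F` of `f`, where `F` is the stem function of `f`, combined with a pointwise
bound on the boundary circle.

For every imaginary unit `I` one has `|N(z)| ≤ |f(z_I)| |f(z_{-I})|`, with `z_I = α + βI`
(`norm_normSq_le`); this is the only source of inequality. Replacing `θ` by `2π - θ` exchanges `I`
and `-I`, so integrating logarithms over the circle and over `μ` bounds the circle average of `log
|N|` by `2A` (`circleAverage_le_boundaryLogMean`). At the centre `F` has no `ι`-component, hence
`N(0) = |f(0)|²` (`IsSemiRegular.trailingCoeff_zero`). A linear factor with zero on `𝕊_z` has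
symmetrization `(w - z)(w - z̄)`, so a divisor coefficient `m` gives `N` order `m` at each of `z`,
`z̄` if `z` is not real, and order `2m` if it is. The divisor sum for `N` is therefore twice the
slice divisor sum (`IsSemiRegular.finsum_divisor`). Halving gives the second formula. The first is
the same sum split up: the coefficient is `n + 2m` on a non-real sphere with spherical exponent `m`
and punctual multiplicity `n`, and the order of `f` at a real point
(`HasLocalForm.sliceDivisor_balance`).

The remaining work shows that these multiplicities exist and are unique. Existence rests on dividing
a vanishing slice regular function by `q - a` (`exists_eq_linearStem_mul`) until the symmetrization
has order zero (`exists_factorization`). Uniqueness comes from the order of `N` and from the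
position of the zeros on the sphere (`HasSphericalForm.unique`). The symmetrization is not locally
zero in the closed disc because it is not so near `0` (`IsSemiRegular.order_ne_top`). -/

theorem mem_imUnits_iff {I : ℍ} :
    I ∈ imUnits ↔ I.re = 0 ∧ I.imI ^ 2 + I.imJ ^ 2 + I.imK ^ 2 = 1 := by
  obtain ⟨a, b, c, d⟩ := I
  simp only [imUnits, Quaternion.ext_iff, Quaternion.re_mul, Quaternion.imI_mul,
    Quaternion.imJ_mul, Quaternion.imK_mul, Quaternion.re_neg, Quaternion.imI_neg,
    Quaternion.imJ_neg, Quaternion.imK_neg, Quaternion.re_one, Quaternion.imI_one,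
    Quaternion.imJ_one, Quaternion.imK_one]
  constructor
  · rintro ⟨h0, h1, h2, h3⟩
    have ha : a = 0 := by
      by_contra ha
      have hb : b = 0 := by
        have : a * b = 0 := by linarith
        simpa [ha] using this
      have hc : c = 0 := by
        have : a * c = 0 := by linarith
        simpa [ha] using this
      have hd : d = 0 := by
        have : a * d = 0 := by linarith
        simpa [ha] using this
      subst hb hc hd
      nlinarith [sq_nonneg a]
    subst ha
    exact ⟨rfl, by linarith⟩
  · rintro ⟨rfl, h⟩
    refine ⟨by linarith, by ring, by ring, by ring⟩

theorem neg_mem_imUnits {I : ℍ} (h : I ∈ imUnits) : -I ∈ imUnits := by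
  simpa [imUnits] using h

theorem star_eq_neg_of_mem_imUnits {I : ℍ} (h : I ∈ imUnits) : star I = -I := by
  have := (mem_imUnits_iff.1 h).1
  ext <;> simp [this]

theorem imUnits_mul_self {I : ℍ} (h : I ∈ imUnits) : I * I = -1 := h

theorem norm_eq_one_of_mem_imUnits {I : ℍ} (h : I ∈ imUnits) : ‖I‖ = 1 := by
  have h1 : ‖I * I‖ = 1 := by rw [imUnits_mul_self h, norm_neg, norm_one]
  rw [norm_mul] at h1
  nlinarith [norm_nonneg I]

/-- A distinguished imaginary unit. -/
def stdUnit : ℍ := ⟨0, 1, 0, 0⟩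

theorem stdUnit_mem : stdUnit ∈ imUnits := mem_imUnits_iff.2 ⟨rfl, by norm_num [stdUnit]⟩

theorem star_slicePoint {I : ℍ} (h : I ∈ imUnits) (z : ℂ) :
    star (slicePoint z I) = slicePoint z (-I) := by
  simp [slicePoint, star_eq_neg_of_mem_imUnits h]

theorem slicePoint_conj (z : ℂ) (I : ℍ) : slicePoint (conj z) I = slicePoint z (-I) := by
  simp [slicePoint]

theorem slicePoint_re {I : ℍ} (h : I ∈ imUnits) (z : ℂ) : (slicePoint z I).re = z.re := by
  simp [slicePoint, (mem_imUnits_iff.1 h).1]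

theorem norm_slicePoint {I : ℍ} (h : I ∈ imUnits) (z : ℂ) : ‖slicePoint z I‖ = ‖z‖ := by
  have h1 : ‖slicePoint z I‖ ^ 2 = ‖z‖ ^ 2 := by
    rw [sq, ← Quaternion.normSq_eq_norm_mul_self, ← Complex.normSq_eq_norm_sq,
      Quaternion.normSq_def', Complex.normSq_apply]
    obtain ⟨h0, h1⟩ := mem_imUnits_iff.1 h
    simp [slicePoint, h0]
    linear_combination z.im ^ 2 * h1
  exact (sq_eq_sq₀ (norm_nonneg _) (norm_nonneg _)).1 h1

theorem slicePoint_ofReal (x : ℝ) (I : ℍ) : slicePoint (x : ℂ) I = (x : ℍ) := by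
  simp [slicePoint]

/-- The point of the closed upper half plane parametrizing the sphere through `q`. -/
def upperPoint (q : ℍ) : ℂ := ⟨q.re, ‖q.im‖⟩

open Classical in
/-- An imaginary unit `I` such that `q` is the value of `slicePoint` at `I`. -/
def unitOf (q : ℍ) : ℍ := if q.im = 0 then stdUnit else ‖q.im‖⁻¹ • q.im

theorem unitOf_mem (q : ℍ) : unitOf q ∈ imUnits := by
  unfold unitOf
  split_ifs with h
  · exact stdUnit_mem
  · have hn : ‖q.im‖ ≠ 0 := norm_ne_zero_iff.2 h
    have h2 : ‖q.im‖ * ‖q.im‖ = q.imI ^ 2 + q.imJ ^ 2 + q.imK ^ 2 := by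
      rw [← Quaternion.normSq_eq_norm_mul_self, Quaternion.normSq_def']
      simp
    rw [mem_imUnits_iff]
    refine ⟨by simp, ?_⟩
    simp only [Quaternion.imI_smul, Quaternion.imJ_smul, Quaternion.imK_smul, smul_eq_mul,
      Quaternion.imI_im, Quaternion.imJ_im, Quaternion.imK_im]
    field_simp
    linarith

theorem slicePoint_upperPoint (q : ℍ) : slicePoint (upperPoint q) (unitOf q) = q := by
  unfold slicePoint upperPoint unitOf
  split_ifs with h
  · simpa [h] using Quaternion.re_add_im q
  · have hn : ‖q.im‖ ≠ 0 := norm_ne_zero_iff.2 h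
    simp only [smul_smul, mul_inv_cancel₀ hn, one_smul]
    exact Quaternion.re_add_im q

theorem upperPoint_im_nonneg (q : ℍ) : 0 ≤ (upperPoint q).im := norm_nonneg _

theorem norm_upperPoint (q : ℍ) : ‖upperPoint q‖ = ‖q‖ := by
  rw [← norm_slicePoint (unitOf_mem q), slicePoint_upperPoint]

theorem upperPoint_slicePoint {I : ℍ} (h : I ∈ imUnits) (z : ℂ) :
    upperPoint (slicePoint z I) = ⟨z.re, |z.im|⟩ := by
  have h1 : (slicePoint z I).im = z.im • I := by
    have := (mem_imUnits_iff.1 h).1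
    ext <;> simp [slicePoint, this]
  unfold upperPoint
  rw [h1, slicePoint_re h, norm_smul, norm_eq_one_of_mem_imUnits h, mul_one, Real.norm_eq_abs]

theorem upperPoint_of_mem_sphereOf {q : ℍ} {z : ℂ} (hq : q ∈ sphereOf z) :
    upperPoint q = ⟨z.re, |z.im|⟩ := by
  obtain ⟨I, hI, rfl⟩ := hq
  exact upperPoint_slicePoint hI z

theorem upperPoint_eq_of_mem_sphereOf {q : ℍ} {z : ℂ} (hz : 0 ≤ z.im) (hq : q ∈ sphereOf z) :
    upperPoint q = z := by
  rw [upperPoint_of_mem_sphereOf hq, abs_of_nonneg hz]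

theorem mem_sphereOf_upperPoint (q : ℍ) : q ∈ sphereOf (upperPoint q) :=
  ⟨unitOf q, unitOf_mem q, (slicePoint_upperPoint q).symm⟩

theorem sphereOf_conj (z : ℂ) : sphereOf (conj z) = sphereOf z := by
  ext q
  constructor <;> rintro ⟨I, hI, rfl⟩
  · exact ⟨-I, neg_mem_imUnits hI, slicePoint_conj z I⟩
  · exact ⟨-I, neg_mem_imUnits hI, by rw [slicePoint_conj, neg_neg]⟩

theorem upperPoint_eq_or {z w : ℂ} (h : (⟨w.re, |w.im|⟩ : ℂ) = ⟨z.re, |z.im|⟩) :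
    w = z ∨ w = conj z := by
  obtain ⟨h1, h2⟩ := Complex.ext_iff.1 h
  simp only at h1 h2
  rcases abs_eq_abs.1 h2 with h2 | h2
  · exact Or.inl (Complex.ext h1 h2)
  · exact Or.inr (Complex.ext h1 (by simpa using h2))

theorem mem_sphereOf_iff_upperPoint {q : ℍ} {z : ℂ} :
    q ∈ sphereOf z ↔ upperPoint q = z ∨ upperPoint q = conj z := by
  constructor
  · intro h
    apply upperPoint_eq_or
    rw [← upperPoint_of_mem_sphereOf h]
    apply Complex.ext
    · rfl
    · exact abs_of_nonneg (upperPoint_im_nonneg q)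
  · rintro (h | h)
    · exact h ▸ mem_sphereOf_upperPoint q
    · rw [← sphereOf_conj]
      exact h ▸ mem_sphereOf_upperPoint q

theorem slicePoint_injective_unit {z : ℂ} (hz : z.im ≠ 0) {I J : ℍ}
    (h : slicePoint z I = slicePoint z J) : I = J := by
  have := add_left_cancel h
  exact smul_right_injective _ hz this

/-! ### Components of stem values -/

@[simp] theorem stemRe_re (X : ℍ[ℂ]) : (stemRe X).re = X.re.re := rfl

@[simp] theorem stemRe_imI (X : ℍ[ℂ]) : (stemRe X).imI = X.imI.re := rfl

@[simp] theorem stemRe_imJ (X : ℍ[ℂ]) : (stemRe X).imJ = X.imJ.re := rfl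

@[simp] theorem stemRe_imK (X : ℍ[ℂ]) : (stemRe X).imK = X.imK.re := rfl

@[simp] theorem stemIm_re (X : ℍ[ℂ]) : (stemIm X).re = X.re.im := rfl

@[simp] theorem stemIm_imI (X : ℍ[ℂ]) : (stemIm X).imI = X.imI.im := rfl

@[simp] theorem stemIm_imJ (X : ℍ[ℂ]) : (stemIm X).imJ = X.imJ.im := rfl

@[simp] theorem stemIm_imK (X : ℍ[ℂ]) : (stemIm X).imK = X.imK.im := rfl

@[simp] theorem complexConj_re (X : ℍ[ℂ]) : (complexConj X).re = conj X.re := rfl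

@[simp] theorem complexConj_imI (X : ℍ[ℂ]) : (complexConj X).imI = conj X.imI := rfl

@[simp] theorem complexConj_imJ (X : ℍ[ℂ]) : (complexConj X).imJ = conj X.imJ := rfl

@[simp] theorem complexConj_imK (X : ℍ[ℂ]) : (complexConj X).imK = conj X.imK := rfl

@[simp] theorem toComplexified_re (a : ℍ) : (toComplexified a).re = (a.re : ℂ) := rfl

@[simp] theorem toComplexified_imI (a : ℍ) : (toComplexified a).imI = (a.imI : ℂ) := rfl

@[simp] theorem toComplexified_imJ (a : ℍ) : (toComplexified a).imJ = (a.imJ : ℂ) := rfl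

@[simp] theorem toComplexified_imK (a : ℍ) : (toComplexified a).imK = (a.imK : ℂ) := rfl

@[simp] theorem linearStem_re (a : ℍ) (w : ℂ) : (linearStem a w).re = w - a.re := by
  simp [linearStem, Quaternion.algebraMap_def]

@[simp] theorem linearStem_imI (a : ℍ) (w : ℂ) : (linearStem a w).imI = -(a.imI : ℂ) := by
  simp [linearStem, Quaternion.algebraMap_def]

@[simp] theorem linearStem_imJ (a : ℍ) (w : ℂ) : (linearStem a w).imJ = -(a.imJ : ℂ) := by
  simp [linearStem, Quaternion.algebraMap_def]

@[simp] theorem linearStem_imK (a : ℍ) (w : ℂ) : (linearStem a w).imK = -(a.imK : ℂ) := by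
  simp [linearStem, Quaternion.algebraMap_def]

theorem mul_complex_smul (c : ℂ) (X Y : ℍ[ℂ]) : X * (c • Y) = c • (X * Y) := by
  ext <;> simp <;> ring

theorem zero_complex_smul (X : ℍ[ℂ]) : (0 : ℂ) • X = 0 := by
  ext <;> simp

theorem complex_smul_mul (c : ℂ) (X Y : ℍ[ℂ]) : (c • X) * Y = c • (X * Y) := by
  ext <;> simp <;> ring

/-- The element `p + q ι` of the complexification. -/
def stemMk (p q : ℍ) : ℍ[ℂ] :=
  ⟨⟨p.re, q.re⟩, ⟨p.imI, q.imI⟩, ⟨p.imJ, q.imJ⟩, ⟨p.imK, q.imK⟩⟩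

@[simp] theorem stemRe_stemMk (p q : ℍ) : stemRe (stemMk p q) = p := rfl

@[simp] theorem stemIm_stemMk (p q : ℍ) : stemIm (stemMk p q) = q := rfl

theorem stem_ext {X Y : ℍ[ℂ]} (h1 : stemRe X = stemRe Y) (h2 : stemIm X = stemIm Y) : X = Y := by
  simp only [Quaternion.ext_iff, stemRe_re, stemRe_imI, stemRe_imJ, stemRe_imK, stemIm_re,
    stemIm_imI, stemIm_imJ, stemIm_imK] at h1 h2
  ext <;> apply Complex.ext <;> tauto

theorem stemRe_mul (X Y : ℍ[ℂ]) :
    stemRe (X * Y) = stemRe X * stemRe Y - stemIm X * stemIm Y := by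
  ext <;> simp <;> ring

theorem stemIm_mul (X Y : ℍ[ℂ]) :
    stemIm (X * Y) = stemRe X * stemIm Y + stemIm X * stemRe Y := by
  ext <;> simp <;> ring

theorem stemRe_smul (c : ℂ) (X : ℍ[ℂ]) :
    stemRe (c • X) = c.re • stemRe X - c.im • stemIm X := by
  ext <;> simp

theorem stemIm_smul (c : ℂ) (X : ℍ[ℂ]) :
    stemIm (c • X) = c.re • stemIm X + c.im • stemRe X := by
  ext <;> simp

theorem stemRe_complexConj (X : ℍ[ℂ]) : stemRe (complexConj X) = stemRe X := by
  ext <;> simp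

theorem stemIm_complexConj (X : ℍ[ℂ]) : stemIm (complexConj X) = -stemIm X := by
  ext <;> simp

theorem evalAt_complexConj (X : ℍ[ℂ]) (I : ℍ) : evalAt (complexConj X) I = evalAt X (-I) := by
  simp [evalAt, stemRe_complexConj, stemIm_complexConj]

theorem complexConj_mul (X Y : ℍ[ℂ]) :
    complexConj (X * Y) = complexConj X * complexConj Y := by
  ext <;> simp

theorem complexConj_star (X : ℍ[ℂ]) : complexConj (star X) = star (complexConj X) := by
  ext <;> simp

theorem complexConj_smul (c : ℂ) (X : ℍ[ℂ]) :
    complexConj (c • X) = conj c • complexConj X := by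
  ext <;> simp

theorem normSq_complexConj (X : ℍ[ℂ]) :
    Quaternion.normSq (complexConj X) = conj (Quaternion.normSq X) := by
  simp [Quaternion.normSq_def']

theorem evalAt_zero (I : ℍ) : evalAt 0 I = 0 := by
  ext <;> simp [evalAt]

/-- The sum of the two values is `2p` and, once `p` is known, either value gives `Iq`; so one
complex slice determines a stem value. -/
theorem evalAt_injective {I : ℍ} (hI : I ∈ imUnits) {X Y : ℍ[ℂ]} (h : evalAt X I = evalAt Y I)
    (h' : evalAt X (-I) = evalAt Y (-I)) : X = Y := by
  simp only [evalAt, neg_mul] at h h'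
  have h1 : (2 : ℝ) • stemRe X = (2 : ℝ) • stemRe Y := by
    rw [two_smul, two_smul]
    calc _ = (stemRe X + I * stemIm X) + (stemRe X + -(I * stemIm X)) := by abel
      _ = (stemRe Y + I * stemIm Y) + (stemRe Y + -(I * stemIm Y)) := by rw [h, h']
      _ = _ := by abel
  have h1 : stemRe X = stemRe Y := smul_right_injective _ (two_ne_zero) h1
  rw [h1] at h
  have h2 : I * stemIm X = I * stemIm Y := add_left_cancel h
  have h3 : I ≠ 0 := by
    rintro rfl
    simp [imUnits] at hI
  exact stem_ext h1 (mul_left_cancel₀ h3 h2)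

/-- Evaluation at `I` turns `ι` into left multiplication by `I`. It is not multiplicative in
general, but it respects the central scalars. -/
theorem evalAt_smul {I : ℍ} (hI : I ∈ imUnits) (c : ℂ) (X : ℍ[ℂ]) :
    evalAt (c • X) I = slicePoint c I * evalAt X I := by
  have hI2 : I * (I * stemIm X) = -stemIm X := by
    rw [← mul_assoc, imUnits_mul_self hI, neg_one_mul]
  simp only [evalAt, stemRe_smul, stemIm_smul, slicePoint, mul_add, add_mul, smul_mul_assoc,
    mul_smul_comm, hI2, Quaternion.coe_mul_eq_smul, smul_neg]
  abel

theorem norm_evalAt_smul {I : ℍ} (hI : I ∈ imUnits) (c : ℂ) (X : ℍ[ℂ]) :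
    ‖evalAt (c • X) I‖ = ‖c‖ * ‖evalAt X I‖ := by
  rw [evalAt_smul hI, norm_mul, norm_slicePoint hI]

/-! ### Symmetrization compared with the values on a sphere. -/

theorem normSq_smul_complex (c : ℂ) (X : ℍ[ℂ]) :
    Quaternion.normSq (c • X) = c ^ 2 * Quaternion.normSq X := Quaternion.normSq_smul c X

/-- Write `X = p + qι`, `A = |p|²`, `B = |q|²`, `t = ⟨p, q⟩`, let `v` be the imaginary part of `p
q̄`, and put `s = ⟨I, v⟩`. The left side is `(A - B)² + 4t²`, while `|p ± Iq|² = A + B ± 2s`. Since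
`AB = t² + |v|²`, the right side exceeds the left by `4(|v|² - s²)`, which is nonnegative by
Cauchy–Schwarz. -/
theorem norm_normSq_sq_le (X : ℍ[ℂ]) {I : ℍ} (hI : I ∈ imUnits) :
    ‖Quaternion.normSq X‖ ^ 2 ≤ (‖evalAt X I‖ * ‖evalAt X (-I)‖) ^ 2 := by
  obtain ⟨h0, h1⟩ := mem_imUnits_iff.1 hI
  rw [mul_pow, sq ‖evalAt X I‖, sq ‖evalAt X (-I)‖, ← Quaternion.normSq_eq_norm_mul_self,
    ← Quaternion.normSq_eq_norm_mul_self, ← Complex.normSq_eq_norm_sq]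
  simp only [evalAt, Quaternion.normSq_def', Quaternion.re_add, Quaternion.imI_add,
    Quaternion.imJ_add, Quaternion.imK_add, Quaternion.re_mul, Quaternion.imI_mul,
    Quaternion.imJ_mul, Quaternion.imK_mul, Quaternion.re_neg, Quaternion.imI_neg,
    Quaternion.imJ_neg, Quaternion.imK_neg, stemRe_re, stemRe_imI, stemRe_imJ, stemRe_imK,
    stemIm_re, stemIm_imI, stemIm_imJ, stemIm_imK, Complex.normSq_apply, pow_two, Complex.add_re,
    Complex.mul_re, Complex.add_im, Complex.mul_im, h0]
  generalize X.re.re = a0, X.imI.re = a1, X.imJ.re = a2, X.imK.re = a3, X.re.im = b0,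
    X.imI.im = b1, X.imJ.im = b2, X.imK.im = b3
  generalize I.imI = i1, I.imJ = i2, I.imK = i3 at h1 ⊢
  have hq : (i1 ^ 2 + i2 ^ 2 + i3 ^ 2) * (b0 ^ 2 + b1 ^ 2 + b2 ^ 2 + b3 ^ 2)
    = b0 ^ 2 + b1 ^ 2 + b2 ^ 2 + b3 ^ 2 := by rw [h1, one_mul]
  obtain ⟨v1, hv1⟩ : ∃ v, v = a1 * b0 - a0 * b1 - (a2 * b3 - a3 * b2) := ⟨_, rfl⟩
  obtain ⟨v2, hv2⟩ : ∃ v, v = a2 * b0 - a0 * b2 - (a3 * b1 - a1 * b3) := ⟨_, rfl⟩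
  obtain ⟨v3, hv3⟩ : ∃ v, v = a3 * b0 - a0 * b3 - (a1 * b2 - a2 * b1) := ⟨_, rfl⟩
  obtain ⟨t, ht⟩ : ∃ t, t = a0 * b0 + a1 * b1 + a2 * b2 + a3 * b3 := ⟨_, rfl⟩
  obtain ⟨A, hA⟩ : ∃ t, t = a0 ^ 2 + a1 ^ 2 + a2 ^ 2 + a3 ^ 2 := ⟨_, rfl⟩
  obtain ⟨B, hB⟩ : ∃ t, t = b0 ^ 2 + b1 ^ 2 + b2 ^ 2 + b3 ^ 2 := ⟨_, rfl⟩
  obtain ⟨s, hs⟩ : ∃ t, t = i1 * v1 + i2 * v2 + i3 * v3 := ⟨_, rfl⟩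
  have e4 : A * B = t ^ 2 + v1 ^ 2 + v2 ^ 2 + v3 ^ 2 := by
    rw [hA, hB, ht, hv1, hv2, hv3]
    ring
  -- Lagrange's identity for the unit vector `I` and `v`; the bracket is `|I × v|²`.
  have e5 : s ^ 2 + ((i1 * v2 - i2 * v1) ^ 2 + (i2 * v3 - i3 * v2) ^ 2 + (i3 * v1 - i1 * v3) ^ 2)
      = v1 ^ 2 + v2 ^ 2 + v3 ^ 2 := by
    rw [hs]
    linear_combination (v1 ^ 2 + v2 ^ 2 + v3 ^ 2) * h1
  have e6 : (A + B + 2 * s) * (A + B - 2 * s) = (A - B) ^ 2 + 4 * (A * B) - 4 * s ^ 2 := by ring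
  have e7 : (A - B) ^ 2 + 4 * t ^ 2 ≤ (A + B + 2 * s) * (A + B - 2 * s) := by
    linarith [sq_nonneg (i1 * v2 - i2 * v1), sq_nonneg (i2 * v3 - i3 * v2),
      sq_nonneg (i3 * v1 - i1 * v3)]
  refine le_of_eq_of_le (?_ : _ = (A - B) ^ 2 + 4 * t ^ 2)
    (e7.trans_eq (congrArg₂ (· * ·) (?_ : A + B + 2 * s = _) (?_ : A + B - 2 * s = _)))
  · rw [hA, hB, ht]
    ring
  · rw [hA, hB, hs, hv1, hv2, hv3]
    linear_combination -hq
  · rw [hA, hB, hs, hv1, hv2, hv3]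
    linear_combination -hq

theorem norm_normSq_le (X : ℍ[ℂ]) {I : ℍ} (hI : I ∈ imUnits) :
    ‖Quaternion.normSq X‖ ≤ ‖evalAt X I‖ * ‖evalAt X (-I)‖ :=
  (sq_le_sq₀ (norm_nonneg _) (by positivity)).1 (norm_normSq_sq_le X hI)

/-- The real and imaginary parts of the hypothesis say that `p` and `q` have equal norm and are
orthogonal. If `q ≠ 0`, then `p q⁻¹` is a purely imaginary unit and `I = -p q⁻¹` solves `p + Iq =
0`. -/
theorem exists_evalAt_eq_zero {X : ℍ[ℂ]} (h : Quaternion.normSq X = 0) :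
    ∃ I ∈ imUnits, evalAt X I = 0 := by
  set p := stemRe X with hp
  set q := stemIm X with hq
  have h1 : Quaternion.normSq p = Quaternion.normSq q := by
    have := congrArg Complex.re h
    simp only [Quaternion.normSq_def', sq, Complex.add_re, Complex.mul_re, Complex.zero_re] at this
    simp only [hp, hq, stemRe_re, stemRe_imI, stemRe_imJ, stemRe_imK, stemIm_re, stemIm_imI, stemIm_imJ, stemIm_imK, Quaternion.normSq_def']
    linarith
  have h2 : (p * star q).re = 0 := by
    have := congrArg Complex.im h
    simp only [Quaternion.normSq_def', sq, Complex.add_im, Complex.mul_im, Complex.zero_im] at this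
    simp only [hp, hq, stemRe_re, stemRe_imI, stemRe_imJ, stemRe_imK, stemIm_re, stemIm_imI, stemIm_imJ, stemIm_imK, Quaternion.re_mul, Quaternion.re_star, Quaternion.imI_star,
      Quaternion.imJ_star, Quaternion.imK_star]
    linarith
  by_cases hq0 : q = 0
  · refine ⟨stdUnit, stdUnit_mem, ?_⟩
    have : p = 0 := by
      rw [hq0, map_zero] at h1
      exact Quaternion.normSq_eq_zero.1 h1
    simp [evalAt, ← hp, ← hq, hq0, this]
  · have hqn : Quaternion.normSq q ≠ 0 := Quaternion.normSq_ne_zero.2 hq0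
    refine ⟨-(p * q⁻¹), ?_, ?_⟩
    · apply neg_mem_imUnits
      have hre : (p * q⁻¹).re = 0 := by
        have hi : q⁻¹ = (Quaternion.normSq q)⁻¹ • star q := rfl
        rw [hi, mul_smul_comm, Quaternion.re_smul, h2, smul_zero]
      have hn : Quaternion.normSq (p * q⁻¹) = 1 := by
        rw [map_mul, Quaternion.normSq_inv, h1, mul_inv_cancel₀ hqn]
      rw [mem_imUnits_iff]
      refine ⟨hre, ?_⟩
      rw [Quaternion.normSq_def', hre] at hn
      linarith
    · simp [evalAt, ← hp, ← hq, hq0]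

theorem normSq_ne_zero_iff {X : ℍ[ℂ]} :
    Quaternion.normSq X ≠ 0 ↔ ∀ I ∈ imUnits, evalAt X I ≠ 0 := by
  constructor
  · intro h I hI h0
    have := norm_normSq_le X hI
    rw [h0, norm_zero, zero_mul] at this
    exact h (norm_le_zero_iff.1 this)
  · intro h h0
    obtain ⟨I, hI, hI0⟩ := exists_evalAt_eq_zero h0
    exact h I hI hI0

/-! ### Linear factors -/

/-- The real quadratic polynomial vanishing at `z` and `conj z`. -/
def sphereQuad (z w : ℂ) : ℂ := (w - (z.re : ℂ)) ^ 2 + (z.im : ℂ) ^ 2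

theorem sphereQuad_eq (z w : ℂ) : sphereQuad z w = (w - z) * (w - conj z) := by
  have h1 : z = z.re + z.im * Complex.I := (Complex.re_add_im z).symm
  have h2 : conj z = z.re - z.im * Complex.I := by
    apply Complex.ext <;> simp
  have h3 : (w - z) * (w - conj z) = (w - (z.re + z.im * Complex.I)) * (w - conj z) := by
    rw [← h1]
  rw [h3, h2, sphereQuad]
  linear_combination ((z.im : ℂ) ^ 2) * Complex.I_sq

theorem sphereQuad_ne_zero {z w : ℂ} (h : w ∉ ({z, conj z} : Set ℂ)) : sphereQuad z w ≠ 0 := by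
  rw [sphereQuad_eq]
  simp only [Set.mem_insert_iff, Set.mem_singleton_iff, not_or] at h
  exact mul_ne_zero (sub_ne_zero.2 h.1) (sub_ne_zero.2 h.2)

theorem sphereQuad_self (z : ℂ) : sphereQuad z z = 0 := by simp [sphereQuad_eq]

theorem sphereQuad_conj (z w : ℂ) : sphereQuad z (conj w) = conj (sphereQuad z w) := by
  simp [sphereQuad]

theorem complexConj_linearStem (a : ℍ) (w : ℂ) :
    complexConj (linearStem a w) = linearStem a (conj w) := by
  ext <;> simp

theorem complexConj_one : complexConj 1 = 1 := by
  ext <;> simp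

theorem linearStemProd_nil (w : ℂ) : linearStemProd [] w = 1 := rfl

theorem linearStemProd_cons (a : ℍ) (l : List ℍ) (w : ℂ) :
    linearStemProd (a :: l) w = linearStem a w * linearStemProd l w := by
  simp [linearStemProd]

theorem normSq_linearStem {z : ℂ} {a : ℍ} (ha : a ∈ sphereOf z) (w : ℂ) :
    Quaternion.normSq (linearStem a w) = sphereQuad z w := by
  obtain ⟨I, hI, rfl⟩ := ha
  obtain ⟨h0, h1⟩ := mem_imUnits_iff.1 hI
  have h2 : (I.imI : ℂ) ^ 2 + (I.imJ : ℂ) ^ 2 + (I.imK : ℂ) ^ 2 = 1 := by exact_mod_cast h1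
  simp only [Quaternion.normSq_def', slicePoint, linearStem_re, linearStem_imI, linearStem_imJ,
    linearStem_imK, Quaternion.re_add, Quaternion.imI_add, Quaternion.imJ_add,
    Quaternion.imK_add, Quaternion.re_smul, Quaternion.imI_smul, Quaternion.imJ_smul,
    Quaternion.imK_smul, Quaternion.re_coe, Quaternion.imI_coe, Quaternion.imJ_coe,
    Quaternion.imK_coe, smul_eq_mul, h0, sphereQuad]
  push_cast
  linear_combination (z.im : ℂ) ^ 2 * h2

theorem normSq_linearStemProd {z : ℂ} {l : List ℍ} (hl : ∀ a ∈ l, a ∈ sphereOf z) (w : ℂ) :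
    Quaternion.normSq (linearStemProd l w) = sphereQuad z w ^ l.length := by
  induction l with
  | nil => simp [linearStemProd]
  | cons a l ih =>
    rw [linearStemProd_cons, map_mul, normSq_linearStem (hl a (by simp)),
      ih (fun b hb => hl b (by simp [hb])), List.length_cons, pow_succ']

theorem star_linearStem (a : ℍ) (w : ℂ) : star (linearStem a w) = linearStem (star a) w := by
  ext <;> simp

theorem linearStem_mul_star {z : ℂ} {a : ℍ} (ha : a ∈ sphereOf z) (w : ℂ) (X : ℍ[ℂ]) :
    linearStem a w * (linearStem (star a) w * X) = sphereQuad z w • X := by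
  rw [← mul_assoc, ← star_linearStem, Quaternion.self_mul_star, normSq_linearStem ha,
    Quaternion.coe_mul_eq_smul]

/-- For a unit `I` one has `I (I - J) = (I - J)(-J)`: moving the left value past `I` turns `I` into
`-J`. Hence, on the sphere of the zero of the linear factor, the right factor is always evaluated at
the conjugate of that zero, whatever `I` is. -/
theorem evalAt_linearStem_mul {z : ℂ} {J : ℍ} (hJ : J ∈ imUnits) (I : ℍ) (X : ℍ[ℂ]) :
    evalAt (linearStem (slicePoint z J) z * X) I
      = (slicePoint z I - slicePoint z J) * evalAt X (-J) := by
  have e1 : stemRe (linearStem (slicePoint z J) z) = -(z.im • J) := by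
    ext <;> simp [slicePoint]
  have e2 : stemIm (linearStem (slicePoint z J) z) = (z.im : ℍ) := by
    ext <;> simp [slicePoint]
  have hJ2 : J * (J * stemIm X) = -stemIm X := by
    rw [← mul_assoc, imUnits_mul_self hJ, neg_one_mul]
  rw [evalAt, stemRe_mul, stemIm_mul, e1, e2]
  simp only [evalAt, slicePoint, add_sub_add_left_eq_sub, mul_add,
    sub_mul, neg_mul, smul_mul_assoc, mul_smul_comm, Quaternion.coe_mul_eq_smul, mul_neg,
    hJ2, smul_neg]
  abel

/-- The zeros on `𝕊_z` of a product of linear factors without conjugate neighbours, times a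
function without zeros on `𝕊_z`. -/
theorem evalAt_linearStemProd_mul_eq_zero_iff {z : ℂ} {K : ℍ[ℂ]}
    (hK : ∀ I ∈ imUnits, evalAt K I ≠ 0) {l : List ℍ} (hl : ∀ p ∈ l, p ∈ sphereOf z)
    (hc : l.IsChain (fun p p' => p' ≠ star p)) {I : ℍ} (hI : I ∈ imUnits) :
    evalAt (linearStemProd l z * K) I = 0 ↔ l.head? = some (slicePoint z I) := by
  induction l generalizing I with
  | nil => simpa [linearStemProd] using hK I hI
  | cons p l ih =>
    obtain ⟨J, hJ, rfl⟩ := hl p (by simp)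
    have ih' := ih (fun b hb => hl b (by simp [hb])) hc.tail (neg_mem_imUnits hJ)
    rw [linearStemProd_cons, mul_assoc, evalAt_linearStem_mul hJ, mul_eq_zero, ih']
    have : ¬ l.head? = some (slicePoint z (-J)) := by
      intro h
      obtain ⟨l', rfl⟩ : ∃ l', l = slicePoint z (-J) :: l' := by
        cases l with
        | nil => simp at h
        | cons b l' => exact ⟨l', by simpa using h⟩
      rw [List.isChain_cons_cons] at hc
      exact hc.1 (star_slicePoint hJ z).symm
    simp [this, sub_eq_zero, eq_comm]

/-- A neighbouring pair `(q - a) * (q - ā)` equals the central factor `sphereQuad z`. Prepending `a`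
to a reduced list either leaves it reduced or cancels its head, as in the reduction of a word. -/
theorem exists_chain_of_linearStemProd {z : ℂ} {l : List ℍ} (hl : ∀ p ∈ l, p ∈ sphereOf z) :
    ∃ (t : ℕ) (l' : List ℍ), (∀ p ∈ l', p ∈ sphereOf z) ∧
      l'.IsChain (fun p p' => p' ≠ star p) ∧ l.length = 2 * t + l'.length ∧
      ∀ w, linearStemProd l w = sphereQuad z w ^ t • linearStemProd l' w := by
  induction l with
  | nil => exact ⟨0, [], by simp, by simp, by simp, by simp⟩
  | cons a l ih =>
    obtain ⟨t, l', h1, h2, h3, h4⟩ := ih (fun b hb => hl b (by simp [hb]))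
    have ha := hl a (by simp)
    by_cases hb : l'.head? = some (star a)
    · obtain ⟨l'', rfl⟩ : ∃ l'', l' = star a :: l'' := by
        cases l' with
        | nil => simp at hb
        | cons b l'' => exact ⟨l'', by simpa using hb⟩
      refine ⟨t + 1, l'', fun p hp => h1 p (by simp [hp]), h2.tail, ?_, fun w => ?_⟩
      · simp only [List.length_cons] at h3 ⊢
        omega
      · rw [linearStemProd_cons, h4, linearStemProd_cons, mul_complex_smul, linearStem_mul_star ha,
          smul_smul, pow_succ]
    · refine ⟨t, a :: l', ?_, ?_, ?_, fun w => ?_⟩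
      · simpa using ⟨ha, h1⟩
      · rw [List.isChain_cons]
        refine ⟨?_, h2⟩
        rintro y hy rfl
        exact hb hy
      · simp only [List.length_cons]
        omega
      · rw [linearStemProd_cons, h4, linearStemProd_cons, mul_complex_smul]

/-! ### Holomorphic stem functions -/

open Filter Topology in
theorem eventually_nhdsNE_ne (w z : ℂ) : ∀ᶠ y in 𝓝[≠] w, y ≠ z := by
  by_cases h : w = z
  · subst h
    exact self_mem_nhdsWithin
  · exact nhdsWithin_le_nhds (isOpen_ne.mem_nhds h)

open Filter Topology in
theorem eventually_nhdsNE_notMem_pair (w z : ℂ) :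
    ∀ᶠ y in 𝓝[≠] w, y ∉ ({z, conj z} : Set ℂ) := by
  filter_upwards [eventually_nhdsNE_ne w z, eventually_nhdsNE_ne w (conj z)] with y h1 h2
  simp [h1, h2]

open Filter Topology in
theorem eventually_mem_punctured {U : Set ℂ} (hU : IsOpen U) {w : ℂ} (hw : w ∈ U) (z : ℂ) :
    ∀ᶠ y in 𝓝[≠] w, y ∈ U \ {z, conj z} := by
  filter_upwards [eventually_nhdsNE_notMem_pair w z, nhdsWithin_le_nhds (hU.mem_nhds hw)]
    with y h1 h2
  exact ⟨h2, h1⟩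

theorem eqOn_of_eqOn_punctured {U : Set ℂ} (hU : IsOpen U) {z : ℂ} {φ ψ : ℂ → ℂ}
    (hφ : ContinuousOn φ U) (hψ : ContinuousOn ψ U)
    (h : ∀ w ∈ U \ {z, conj z}, φ w = ψ w) : ∀ w ∈ U, φ w = ψ w := by
  intro w hw
  have h1 := (hφ.continuousAt (hU.mem_nhds hw)).tendsto.mono_left
    (nhdsWithin_le_nhds (s := {w}ᶜ))
  have h2 := (hψ.continuousAt (hU.mem_nhds hw)).tendsto.mono_left
    (nhdsWithin_le_nhds (s := {w}ᶜ))
  refine tendsto_nhds_unique h1 (h2.congr' ?_)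
  filter_upwards [eventually_mem_punctured hU hw z] with y hy
  exact (h y hy).symm

theorem IsSymmNhd.conj_mem {U : Set ℂ} {z : ℂ} (h : IsSymmNhd U z) : conj z ∈ U :=
  h.2.1 z h.2.2

theorem IsSymmNhd.inter {U V : Set ℂ} {z : ℂ} (h : IsSymmNhd U z) (h' : IsSymmNhd V z) :
    IsSymmNhd (U ∩ V) z :=
  ⟨h.1.inter h'.1, fun w hw => ⟨h.2.1 w hw.1, h'.2.1 w hw.2⟩, h.2.2, h'.2.2⟩

theorem IsHolStem.mono {U V : Set ℂ} {F : ℂ → ℍ[ℂ]} (h : IsHolStem U F) (hV : V ⊆ U) :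
    IsHolStem V F :=
  ⟨fun w hw => h.stem w (hV hw), h.diff_re.mono hV, h.diff_imI.mono hV, h.diff_imJ.mono hV,
    h.diff_imK.mono hV⟩

theorem IsHolStem.mul {U : Set ℂ} {F G : ℂ → ℍ[ℂ]} (hF : IsHolStem U F) (hG : IsHolStem U G) :
    IsHolStem U (fun w => F w * G w) := by
  obtain ⟨f, f0, f1, f2, f3⟩ := hF
  obtain ⟨g, g0, g1, g2, g3⟩ := hG
  refine ⟨fun w hw => by rw [complexConj_mul, f w hw, g w hw], ?_, ?_, ?_, ?_⟩ <;>
    simp only [Quaternion.re_mul, Quaternion.imI_mul, Quaternion.imJ_mul, Quaternion.imK_mul] <;>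
    fun_prop

theorem IsHolStem.star {U : Set ℂ} {F : ℂ → ℍ[ℂ]} (hF : IsHolStem U F) :
    IsHolStem U (fun w => star (F w)) := by
  obtain ⟨f, f0, f1, f2, f3⟩ := hF
  refine ⟨fun w hw => by rw [complexConj_star, f w hw], ?_, ?_, ?_, ?_⟩ <;>
    simp only [Quaternion.re_star, Quaternion.imI_star, Quaternion.imJ_star,
      Quaternion.imK_star] <;>
    fun_prop

theorem IsHolStem.smul {U : Set ℂ} {F : ℂ → ℍ[ℂ]} {c : ℂ → ℂ} (hc : DifferentiableOn ℂ c U)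
    (hc' : ∀ w ∈ U, c (conj w) = conj (c w)) (hF : IsHolStem U F) :
    IsHolStem U (fun w => c w • F w) := by
  obtain ⟨f, f0, f1, f2, f3⟩ := hF
  refine ⟨fun w hw => by rw [complexConj_smul, f w hw, hc' w hw], ?_, ?_, ?_, ?_⟩ <;>
    simp only [Quaternion.re_smul, Quaternion.imI_smul, Quaternion.imJ_smul,
      Quaternion.imK_smul, smul_eq_mul] <;>
    fun_prop

theorem isHolStem_one (U : Set ℂ) : IsHolStem U (fun _ => 1) :=
  ⟨fun _ _ => complexConj_one.symm, by simp, by simp, by simp, by simp⟩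

theorem isHolStem_linearStem (U : Set ℂ) (a : ℍ) : IsHolStem U (linearStem a) := by
  refine ⟨fun w _ => (complexConj_linearStem a w).symm, ?_, ?_, ?_, ?_⟩ <;>
    simp only [linearStem_re, linearStem_imI, linearStem_imJ, linearStem_imK] <;>
    fun_prop

theorem isHolStem_linearStemProd (U : Set ℂ) (l : List ℍ) : IsHolStem U (linearStemProd l) := by
  induction l with
  | nil => exact isHolStem_one U
  | cons a l ih =>
    have := (isHolStem_linearStem U a).mul ih
    simpa only [← linearStemProd_cons] using this

theorem IsHolStem.differentiableOn_normSq {U : Set ℂ} {F : ℂ → ℍ[ℂ]} (hF : IsHolStem U F) :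
    DifferentiableOn ℂ (fun w => Quaternion.normSq (F w)) U := by
  obtain ⟨f, f0, f1, f2, f3⟩ := hF
  simp only [Quaternion.normSq_def']
  fun_prop

theorem IsHolStem.normSq_conj {U : Set ℂ} {F : ℂ → ℍ[ℂ]} (hF : IsHolStem U F) :
    ∀ w ∈ U, Quaternion.normSq (F (conj w)) = conj (Quaternion.normSq (F w)) := fun w hw => by
  rw [hF.stem w hw, normSq_complexConj]

theorem IsHolStem.analyticAt_normSq {U : Set ℂ} (hU : IsOpen U) {F : ℂ → ℍ[ℂ]}
    (hF : IsHolStem U F) {z : ℂ} (hz : z ∈ U) :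
    AnalyticAt ℂ (fun w => Quaternion.normSq (F w)) z :=
  hF.differentiableOn_normSq.analyticAt (hU.mem_nhds hz)

theorem IsHolStem.eqOn_of_punctured {U : Set ℂ} (hU : IsOpen U) {z : ℂ} {F G : ℂ → ℍ[ℂ]}
    (hF : IsHolStem U F) (hG : IsHolStem U G) (h : ∀ w ∈ U \ {z, conj z}, F w = G w) :
    ∀ w ∈ U, F w = G w := by
  intro w hw
  ext1
  · exact eqOn_of_eqOn_punctured hU hF.diff_re.continuousOn hG.diff_re.continuousOn
      (fun y hy => by rw [h y hy]) w hw
  · exact eqOn_of_eqOn_punctured hU hF.diff_imI.continuousOn hG.diff_imI.continuousOn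
      (fun y hy => by rw [h y hy]) w hw
  · exact eqOn_of_eqOn_punctured hU hF.diff_imJ.continuousOn hG.diff_imJ.continuousOn
      (fun y hy => by rw [h y hy]) w hw
  · exact eqOn_of_eqOn_punctured hU hF.diff_imK.continuousOn hG.diff_imK.continuousOn
      (fun y hy => by rw [h y hy]) w hw

theorem differentiable_sphereQuad (z : ℂ) : Differentiable ℂ (sphereQuad z) := by
  unfold sphereQuad
  fun_prop

/-! ### Removal of zeros -/

theorem conj_eq_of_eqOn_punctured {U : Set ℂ} (hU : IsOpen U) (hs : IsSymmetricSet U) {z : ℂ}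
    {k : ℂ → ℂ} (hk : DifferentiableOn ℂ k U)
    (h : ∀ w ∈ U \ {z, conj z}, k (conj w) = conj (k w)) :
    ∀ w ∈ U, k (conj w) = conj (k w) :=
  eqOn_of_eqOn_punctured hU (hk.continuousOn.comp Complex.continuous_conj.continuousOn hs)
    (Complex.continuous_conj.comp_continuousOn hk.continuousOn) h

/-- Division is done on the four complex components. The symmetry of each quotient follows from that
of `P` and `X` where `P ≠ 0`, and extends to the sphere of `z` by continuity. Leaving divisibility
as a hypothesis serves both `P = w - z` with `z` real and `P = sphereQuad z`. -/
theorem exists_isHolStem_of_dvd {U : Set ℂ} (hU : IsOpen U) (hs : IsSymmetricSet U) {z : ℂ}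
    {P : ℂ → ℂ} (hP : ∀ w ∈ U \ {z, conj z}, P w ≠ 0) (hP' : ∀ w, P (conj w) = conj (P w))
    {X : ℂ → ℍ[ℂ]} (hX : IsHolStem U X)
    (hdiv : ∀ g : ℂ → ℂ, DifferentiableOn ℂ g U → (g = (fun w => (X w).re) ∨
      g = (fun w => (X w).imI) ∨ g = (fun w => (X w).imJ) ∨ g = (fun w => (X w).imK)) →
      ∃ k : ℂ → ℂ, DifferentiableOn ℂ k U ∧ ∀ w ∈ U, g w = P w * k w) :
    ∃ K : ℂ → ℍ[ℂ], IsHolStem U K ∧ ∀ w ∈ U, X w = P w • K w := by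
  obtain ⟨k0, d0, e0⟩ := hdiv _ hX.diff_re (by simp)
  obtain ⟨k1, d1, e1⟩ := hdiv _ hX.diff_imI (by simp)
  obtain ⟨k2, d2, e2⟩ := hdiv _ hX.diff_imJ (by simp)
  obtain ⟨k3, d3, e3⟩ := hdiv _ hX.diff_imK (by simp)
  have key : ∀ g k : ℂ → ℂ, (∀ w ∈ U, g w = P w * k w) → DifferentiableOn ℂ k U →
      (∀ w ∈ U, g (conj w) = conj (g w)) → ∀ w ∈ U, k (conj w) = conj (k w) := by
    intro g k hg hk hgc
    apply conj_eq_of_eqOn_punctured hU hs (z := z) hk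
    intro w hw
    have h1 := hgc w hw.1
    rw [hg _ (hs w hw.1), hg w hw.1, map_mul, hP'] at h1
    exact mul_left_cancel₀ ((map_ne_zero _).2 (hP w hw)) h1
  have hst := hX.stem
  refine ⟨fun w => ⟨k0 w, k1 w, k2 w, k3 w⟩, ⟨?_, d0, d1, d2, d3⟩, ?_⟩
  · intro w hw
    ext1
    · exact key _ k0 e0 d0 (fun w hw => by rw [hst w hw, complexConj_re]) w hw
    · exact key _ k1 e1 d1 (fun w hw => by rw [hst w hw, complexConj_imI]) w hw
    · exact key _ k2 e2 d2 (fun w hw => by rw [hst w hw, complexConj_imJ]) w hw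
    · exact key _ k3 e3 d3 (fun w hw => by rw [hst w hw, complexConj_imK]) w hw
  · intro w hw
    ext1
    · exact e0 w hw
    · exact e1 w hw
    · exact e2 w hw
    · exact e3 w hw

theorem exists_eq_sub_mul {U : Set ℂ} (hU : IsOpen U) {z : ℂ} (hz : z ∈ U) {g : ℂ → ℂ}
    (hg : DifferentiableOn ℂ g U) (h0 : g z = 0) :
    ∃ k : ℂ → ℂ, DifferentiableOn ℂ k U ∧ ∀ w, g w = (w - z) * k w := by
  refine ⟨dslope g z, (Complex.differentiableOn_dslope (hU.mem_nhds hz)).2 hg, fun w => ?_⟩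
  rw [← smul_eq_mul, sub_smul_dslope, h0, sub_zero]

theorem stemRe_zero : stemRe 0 = 0 := by ext <;> simp

theorem stemIm_zero : stemIm 0 = 0 := by ext <;> simp

theorem stemIm_eq_zero_of_conj_eq {U : Set ℂ} {F : ℂ → ℍ[ℂ]} (hF : IsHolStem U F) {z : ℂ}
    (hz : z ∈ U) (hr : conj z = z) : stemIm (F z) = 0 := by
  have h := hF.stem z hz
  rw [hr] at h
  have h1 := congrArg stemIm h
  rw [stemIm_complexConj] at h1
  have h2 : (2 : ℝ) • stemIm (F z) = 0 := by
    rw [two_smul]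
    nth_rw 1 [h1]
    exact neg_add_cancel _
  simpa using h2

/-- A slice regular function vanishing at `a` is `(q - a) * k`. -/
theorem exists_eq_linearStem_mul {U : Set ℂ} {z : ℂ} (hU : IsSymmNhd U z) {H : ℂ → ℍ[ℂ]}
    (hH : IsHolStem U H) {I : ℍ} (hI : I ∈ imUnits) (h0 : evalAt (H z) I = 0) :
    ∃ K : ℂ → ℍ[ℂ], IsHolStem U K ∧ ∀ w ∈ U, H w = linearStem (slicePoint z I) w * K w := by
  have ha : slicePoint z I ∈ sphereOf z := ⟨I, hI, rfl⟩
  -- On the real axis the `ι`-component vanishes, so a zero of the function is a zero of all four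
  -- components of `H`.
  by_cases hr : conj z = z
  · have hHz : H z = 0 := by
      have h1 := stemIm_eq_zero_of_conj_eq hH hU.2.2 hr
      apply stem_ext
      · rw [stemRe_zero]
        simpa [evalAt, h1] using h0
      · rw [stemIm_zero, h1]
    have hP' : ∀ w : ℂ, conj w - z = conj (w - z) := by simp [hr]
    obtain ⟨K, hK, hKe⟩ := exists_isHolStem_of_dvd hU.1 hU.2.1 (z := z) (P := fun w => w - z)
      (fun w hw => by
        have := hw.2
        simp only [Set.mem_insert_iff, not_or] at this
        exact sub_ne_zero.2 this.1) hP' hH (by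
        intro g hg hg'
        obtain ⟨k, hk, hk'⟩ := exists_eq_sub_mul hU.1 hU.2.2 hg
          (by rcases hg' with rfl | rfl | rfl | rfl <;> simp [hHz])
        exact ⟨k, hk, fun w _ => hk' w⟩)
    refine ⟨K, hK, fun w hw => ?_⟩
    rw [hKe w hw]
    obtain ⟨x, rfl⟩ := Complex.conj_eq_iff_real.1 hr
    rw [slicePoint_ofReal]
    ext <;> simp
  -- Multiplication by `q - ā` spreads the zero at `a` over the whole sphere, so `X` is divisible by
  -- `sphereQuad z`. The quotient is the required one because `(q - a) * (q - ā)` is `sphereQuad z`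
  -- again.
  · set X : ℂ → ℍ[ℂ] := fun w => linearStem (star (slicePoint z I)) w * H w with hXd
    have hX : IsHolStem U X := (isHolStem_linearStem U _).mul hH
    have hXz : X z = 0 := by
      have h1 : ∀ J, evalAt (X z) J = evalAt 0 J := by
        intro J
        simp only [hXd]
        rw [star_slicePoint hI, evalAt_linearStem_mul (neg_mem_imUnits hI), neg_neg, h0, mul_zero,
          evalAt_zero]
      exact evalAt_injective hI (h1 _) (h1 _)
    have hXz' : X (conj z) = 0 := by
      rw [hX.stem z hU.2.2, hXz]
      ext <;> simp
    obtain ⟨K, hK, hKe⟩ := exists_isHolStem_of_dvd hU.1 hU.2.1 (z := z) (P := sphereQuad z)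
      (fun w hw => sphereQuad_ne_zero hw.2) (sphereQuad_conj z) hX (by
        intro g hg hg'
        obtain ⟨k, hk, hk'⟩ := exists_eq_sub_mul hU.1 hU.2.2 hg
          (by rcases hg' with rfl | rfl | rfl | rfl <;> simp [hXz])
        have hkz : k (conj z) = 0 := by
          have h1 : g (conj z) = 0 := by rcases hg' with rfl | rfl | rfl | rfl <;> simp [hXz']
          rw [hk'] at h1
          exact (mul_eq_zero.1 h1).resolve_left (sub_ne_zero.2 hr)
        obtain ⟨k2, hk2, hk2'⟩ := exists_eq_sub_mul hU.1 hU.conj_mem hk hkz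
        exact ⟨k2, hk2, fun w _ => by rw [hk', hk2', sphereQuad_eq, mul_assoc]⟩)
    refine ⟨K, hK, ?_⟩
    apply hH.eqOn_of_punctured hU.1 (z := z) ((isHolStem_linearStem U _).mul hK)
    intro w hw
    have h1 := linearStem_mul_star ha w (H w)
    have h2 : linearStem (star (slicePoint z I)) w * H w = sphereQuad z w • K w := hKe w hw.1
    rw [h2, mul_complex_smul] at h1
    have h3 := congrArg (fun Y => (sphereQuad z w)⁻¹ • Y) h1
    simp only [smul_smul, inv_mul_cancel₀ (sphereQuad_ne_zero hw.2), one_smul] at h3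
    exact h3.symm

/-- Each extracted factor `q - a` removes one `sphereQuad z` from the symmetrization and so lowers
its order. An upper bound `n` suffices for the induction, and it treats real `z`, where the order
drops by two, in the same way. -/
theorem exists_factorization {U : Set ℂ} {z : ℂ} (hU : IsSymmNhd U z) {n : ℕ} {H : ℂ → ℍ[ℂ]}
    (hH : IsHolStem U H) (hn : analyticOrderAt (fun w => Quaternion.normSq (H w)) z ≤ n) :
    ∃ (l : List ℍ) (K : ℂ → ℍ[ℂ]), (∀ a ∈ l, a ∈ sphereOf z) ∧ IsHolStem U K ∧
      NonvanishingOnSphere K z ∧ ∀ w ∈ U, H w = linearStemProd l w * K w := by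
  induction n generalizing H with
  | zero =>
    refine ⟨[], H, by simp, hH, ?_, fun w _ => by rw [linearStemProd_nil, one_mul]⟩
    have h1 : analyticOrderAt (fun w => Quaternion.normSq (H w)) z = 0 := by simpa using hn
    exact normSq_ne_zero_iff.1
      ((hH.analyticAt_normSq hU.1 hU.2.2).analyticOrderAt_eq_zero.1 h1)
  | succ n ih =>
    by_cases h0 : NonvanishingOnSphere H z
    · exact ⟨[], H, by simp, hH, h0, fun w _ => by rw [linearStemProd_nil, one_mul]⟩
    · simp only [NonvanishingOnSphere, not_forall, not_not] at h0
      obtain ⟨I, hI, h0⟩ := h0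
      obtain ⟨H', hH', he⟩ := exists_eq_linearStem_mul hU hH hI h0
      have ha : slicePoint z I ∈ sphereOf z := ⟨I, hI, rfl⟩
      have hq : AnalyticAt ℂ (sphereQuad z) z :=
        (differentiable_sphereQuad z).analyticAt z
      have h2 : (fun w => Quaternion.normSq (H w)) =ᶠ[nhds z]
          (sphereQuad z * fun w => Quaternion.normSq (H' w)) := by
        filter_upwards [hU.1.mem_nhds hU.2.2] with w hw
        rw [he w hw, map_mul, normSq_linearStem ha]
        rfl
      rw [analyticOrderAt_congr h2, analyticOrderAt_mul hq (hH'.analyticAt_normSq hU.1 hU.2.2)]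
        at hn
      have h3 : 1 ≤ analyticOrderAt (sphereQuad z) z := by
        rw [Order.one_le_iff_ne_zero]
        exact fun h => hq.analyticOrderAt_eq_zero.1 h (sphereQuad_self z)
      have h4 : analyticOrderAt (fun w => Quaternion.normSq (H' w)) z ≤ n := by
        have h5 : 1 + analyticOrderAt (fun w => Quaternion.normSq (H' w)) z ≤ 1 + (n : ℕ∞) := by
          refine (add_le_add_left h3 _).trans (hn.trans_eq ?_)
          push_cast
          rw [add_comm]
        exact (ENat.add_le_add_iff_left ENat.one_ne_top).1 h5
      obtain ⟨l, K, hl, hK, hKz, hKe⟩ := ih hH' h4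
      refine ⟨slicePoint z I :: l, K, by simpa using ⟨ha, hl⟩, hK, hKz, fun w hw => ?_⟩
      rw [he w hw, hKe w hw, linearStemProd_cons, mul_assoc]

theorem exists_factorization_of_ne_top {U : Set ℂ} {z : ℂ} (hU : IsSymmNhd U z) {H : ℂ → ℍ[ℂ]}
    (hH : IsHolStem U H) (hn : analyticOrderAt (fun w => Quaternion.normSq (H w)) z ≠ ⊤) :
    ∃ (l : List ℍ) (K : ℂ → ℍ[ℂ]), (∀ a ∈ l, a ∈ sphereOf z) ∧ IsHolStem U K ∧
      NonvanishingOnSphere K z ∧ ∀ w ∈ U, H w = linearStemProd l w * K w := by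
  obtain ⟨n, hn'⟩ := ENat.ne_top_iff_exists.1 hn
  exact exists_factorization hU hH hn'.symm.le

/-! ### The stem function of a slice function -/

/-- The value of `v` if `v` is finite, and `0` otherwise. -/
def finiteVal (v : OnePoint ℍ) : ℍ := v.elim 0 id

@[simp] theorem finiteVal_coe (q : ℍ) : finiteVal (q : OnePoint ℍ) = q := rfl

@[simp] theorem finiteAbs_coe (q : ℍ) : finiteAbs (q : OnePoint ℍ) = ‖q‖ := rfl

/-- The stem function recovered from the values of `f` on one complex slice. -/
def stemOf (f : ℍ → OnePoint ℍ) (w : ℂ) : ℍ[ℂ] :=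
  stemMk
    ((2 : ℝ)⁻¹ • (finiteVal (f (slicePoint w stdUnit)) + finiteVal (f (slicePoint w (-stdUnit)))))
    (stdUnit * ((2 : ℝ)⁻¹ •
      (finiteVal (f (slicePoint w (-stdUnit))) - finiteVal (f (slicePoint w stdUnit)))))

/-- The symmetrization of `f`, as a function on the complex plane. -/
def symmetrization (f : ℍ → OnePoint ℍ) (w : ℂ) : ℂ := Quaternion.normSq (stemOf f w)

theorem evalAt_stemOf (f : ℍ → OnePoint ℍ) (w : ℂ) :
    evalAt (stemOf f w) stdUnit = finiteVal (f (slicePoint w stdUnit)) := by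
  simp only [evalAt, stemOf, stemRe_stemMk, stemIm_stemMk]
  rw [← mul_assoc, imUnits_mul_self stdUnit_mem, neg_one_mul]
  module

theorem evalAt_stemOf_neg (f : ℍ → OnePoint ℍ) (w : ℂ) :
    evalAt (stemOf f w) (-stdUnit) = finiteVal (f (slicePoint w (-stdUnit))) := by
  simp only [evalAt, stemOf, stemRe_stemMk, stemIm_stemMk]
  rw [← mul_assoc, neg_mul, imUnits_mul_self stdUnit_mem, neg_neg, one_mul]
  module

/-- All local stem functions of `f` are restrictions of one function on the plane, so orders read
from different local descriptions are orders of the same `symmetrization f`. -/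
theorem stemOf_eq {f : ℍ → OnePoint ℍ} {U : Set ℂ} {F : ℂ → ℍ[ℂ]} (h : InducedOn U F f) {w : ℂ}
    (hw : w ∈ U) : stemOf f w = F w := by
  apply evalAt_injective stdUnit_mem
  · rw [evalAt_stemOf, h w hw _ stdUnit_mem, finiteVal_coe]
  · rw [evalAt_stemOf_neg, h w hw _ (neg_mem_imUnits stdUnit_mem), finiteVal_coe]

/-! ### Numbers singled out by a property -/

/-- The alternative `a = 0` covers the default value, taken when no number has the property. -/
theorem numberWith_eq {α : Type} [Zero α] {P : α → Prop} {a : α} (ha : P a ∨ a = 0)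
    (hu : ∀ b, P b → b = a) : numberWith P = a := by
  unfold numberWith
  split_ifs with h
  · exact hu _ h.choose_spec
  · exact (ha.resolve_left fun hp => h ⟨a, hp⟩).symm

/-! ### Orders -/

/-- The order of `sphereQuad z` at `z`. -/
def sphereWeight (z : ℂ) : ℤ := if z.im = 0 then 2 else 1

theorem sphereWeight_pos (z : ℂ) : 0 < sphereWeight z := by
  unfold sphereWeight
  split_ifs <;> norm_num

-- The common measuring device: each kind of multiplicity makes the symmetrization a power of
-- `sphereQuad z` times a nonvanishing analytic function, so its order determines the exponent.
open Filter Topology in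
theorem meromorphicOrderAt_of_sphereQuad {N g : ℂ → ℂ} {z : ℂ} {k : ℤ} (hg : AnalyticAt ℂ g z)
    (hgz : g z ≠ 0) (h : N =ᶠ[𝓝[≠] z] fun w => sphereQuad z w ^ k * g w) :
    meromorphicOrderAt N z = ((sphereWeight z * k : ℤ) : WithTop ℤ) := by
  rw [meromorphicOrderAt_congr h]
  have hz1 : meromorphicOrderAt (fun w : ℂ => w - z) z = 1 := meromorphicOrderAt_id_sub_const
  have hm : MeromorphicAt (sphereQuad z) z :=
    ((differentiable_sphereQuad z).analyticAt z).meromorphicAt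
  have hq : meromorphicOrderAt (sphereQuad z) z = (sphereWeight z : WithTop ℤ) := by
    have he : sphereQuad z = (fun w => w - z) * fun w => w - conj z := by
      ext w
      exact sphereQuad_eq z w
    rw [he, meromorphicOrderAt_mul (by fun_prop) (by fun_prop), hz1]
    unfold sphereWeight
    split_ifs with hz
    · rw [Complex.conj_eq_iff_im.2 hz, hz1]
      rfl
    · have h0 : meromorphicOrderAt (fun w : ℂ => w - conj z) z = 0 := by
        rw [AnalyticAt.meromorphicOrderAt_eq (by fun_prop),
          AnalyticAt.analyticOrderAt_eq_zero (by fun_prop) |>.2]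
        · rfl
        · rw [sub_ne_zero]
          exact fun h => hz (Complex.conj_eq_iff_im.1 h.symm)
      rw [h0]
      rfl
  have hg0 : meromorphicOrderAt g z = 0 := by
    rw [hg.meromorphicOrderAt_eq, hg.analyticOrderAt_eq_zero.2 hgz]
    rfl
  have hz2 := meromorphicOrderAt_zpow hm (n := k)
  have := meromorphicOrderAt_mul (hm.zpow k) hg.meromorphicAt
  rw [hz2, hq, hg0, add_zero] at this
  rw [mul_comm]
  exact this.trans (by norm_cast)

theorem NonvanishingOnSphere.normSq_ne_zero {K : ℂ → ℍ[ℂ]} {z : ℂ}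
    (h : NonvanishingOnSphere K z) : Quaternion.normSq (K z) ≠ 0 := normSq_ne_zero_iff.2 h

/-- Near `𝕊_z` the function `f` is `((q - α)² + β²)^s (q - p₁) * ⋯ * (q - pₙ) * g` with
`pᵢ ∈ 𝕊_z` and `g` without zeros on `𝕊_z`. -/
def HasLocalForm (f : ℍ → OnePoint ℍ) (z : ℂ) (s : ℤ) (l : List ℍ) : Prop :=
  ∃ (U : Set ℂ) (K : ℂ → ℍ[ℂ]), IsSymmNhd U z ∧ IsHolStem U K ∧ NonvanishingOnSphere K z ∧
    (∀ p ∈ l, p ∈ sphereOf z) ∧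
    InducedOn (U \ {z, conj z}) (fun w => sphereQuad z w ^ s • (linearStemProd l w * K w)) f

theorem HasSphericalForm.hasLocalForm {f : ℍ → OnePoint ℍ} {z : ℂ} {s : ℤ} {l : List ℍ}
    (h : HasSphericalForm f z s l) : HasLocalForm f z s l := by
  obtain ⟨U, K, h1, h2, h3, h4, h5, h6⟩ := h
  exact ⟨U, K, h1, h2, h3, h4, h6⟩

theorem HasLocalForm.exists_hasSphericalForm {f : ℍ → OnePoint ℍ} {z : ℂ} {s : ℤ} {l : List ℍ}
    (h : HasLocalForm f z s l) : ∃ (m : ℤ) (l' : List ℍ), HasSphericalForm f z m l' := by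
  obtain ⟨U, K, h1, h2, h3, h4, h6⟩ := h
  obtain ⟨t, l', g1, g2, g3, g4⟩ := exists_chain_of_linearStemProd h4
  refine ⟨s + t, l', U, K, h1, h2, h3, g1, g2, ?_⟩
  intro w hw I hI
  rw [h6 w hw I hI]
  beta_reduce
  rw [g4, complex_smul_mul, smul_smul, ← zpow_natCast,
    ← zpow_add₀ (sphereQuad_ne_zero hw.2)]
  rfl

theorem normSq_localForm {z : ℂ} {l : List ℍ} (hl : ∀ p ∈ l, p ∈ sphereOf z) (s : ℤ) {w : ℂ}
    (hw : w ∉ ({z, conj z} : Set ℂ)) (X : ℍ[ℂ]) :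
    Quaternion.normSq (sphereQuad z w ^ s • (linearStemProd l w * X))
      = sphereQuad z w ^ (2 * s + l.length) * Quaternion.normSq X := by
  rw [normSq_smul_complex, map_mul, normSq_linearStemProd hl,
    zpow_add₀ (sphereQuad_ne_zero hw), mul_comm 2 s, zpow_mul, zpow_natCast, ← mul_assoc]
  rfl

theorem HasLocalForm.meromorphicOrderAt_eq {f : ℍ → OnePoint ℍ} {z : ℂ} {s : ℤ} {l : List ℍ}
    (h : HasLocalForm f z s l) :
    meromorphicOrderAt (symmetrization f) z
      = ((sphereWeight z * (2 * s + l.length) : ℤ) : WithTop ℤ) := by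
  obtain ⟨U, K, h1, h2, h3, h4, h6⟩ := h
  refine meromorphicOrderAt_of_sphereQuad (h2.analyticAt_normSq h1.1 h1.2.2) h3.normSq_ne_zero ?_
  filter_upwards [eventually_mem_punctured h1.1 h1.2.2 z] with w hw
  rw [symmetrization, stemOf_eq h6 hw, normSq_localForm h4 s hw.2]

theorem ofReal_sub_zpow_mul_self {x : ℝ} {w : ℂ} (k : ℤ) :
    ((w - (x : ℂ)) ^ k) ^ 2 = sphereQuad x w ^ k := by
  rw [sphereQuad_eq, Complex.conj_ofReal, mul_zpow, sq]

theorem HasRealOrder.meromorphicOrderAt_eq {f : ℍ → OnePoint ℍ} {x : ℝ} {k : ℤ}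
    (h : HasRealOrder f x k) :
    meromorphicOrderAt (symmetrization f) x = ((2 * k : ℤ) : WithTop ℤ) := by
  obtain ⟨U, K, h1, h2, h3, h6⟩ := h
  have := meromorphicOrderAt_of_sphereQuad (N := symmetrization f) (k := k)
    (h2.analyticAt_normSq h1.1 h1.2.2) h3.normSq_ne_zero ?_
  · simpa [sphereWeight] using this
  · filter_upwards [eventually_mem_punctured h1.1 h1.2.2 x] with w hw
    rw [symmetrization, stemOf_eq h6 (by simpa using hw), normSq_smul_complex,
      ofReal_sub_zpow_mul_self]

theorem linearStem_ofReal_mul (x : ℝ) (w : ℂ) (X : ℍ[ℂ]) :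
    linearStem (x : ℍ) w * X = (w - (x : ℂ)) • X := by
  ext <;> simp

theorem linearStemProd_ofReal_mul {x : ℝ} {l : List ℍ} (hl : ∀ p ∈ l, p ∈ sphereOf x) (w : ℂ)
    (X : ℍ[ℂ]) : linearStemProd l w * X = (w - (x : ℂ)) ^ l.length • X := by
  induction l with
  | nil => simp [linearStemProd_nil]
  | cons a l ih =>
    obtain ⟨I, hI, rfl⟩ := hl a (by simp)
    rw [linearStemProd_cons, mul_assoc, ih (fun b hb => hl b (by simp [hb])), slicePoint_ofReal,
      linearStem_ofReal_mul, smul_smul, List.length_cons, pow_succ']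

/-- At a real point each linear factor is the central `w - x`, and `sphereQuad` is its square. -/
theorem HasLocalForm.hasRealOrder {f : ℍ → OnePoint ℍ} {x : ℝ} {s : ℤ} {l : List ℍ}
    (h : HasLocalForm f x s l) : HasRealOrder f x (2 * s + l.length) := by
  obtain ⟨U, K, h1, h2, h3, h4, h6⟩ := h
  refine ⟨U, K, h1, h2, h3, ?_⟩
  intro w hw I hI
  have hw' : w ∈ U \ {(x : ℂ), conj (x : ℂ)} := by simpa using hw
  have hne : w - (x : ℂ) ≠ 0 := sub_ne_zero.2 hw.2
  rw [h6 w hw' I hI]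
  beta_reduce
  rw [linearStemProd_ofReal_mul h4, smul_smul, ← ofReal_sub_zpow_mul_self,
    zpow_add₀ hne, mul_comm 2 s, zpow_mul, zpow_natCast]
  rfl

theorem HasMultiplicity.eventuallyEq {F : ℂ → ℍ[ℂ]} {z : ℂ} {m : ℕ} (h : HasMultiplicity F z m) :
    ∃ g : ℂ → ℂ, AnalyticAt ℂ g z ∧ g z ≠ 0 ∧
      ∀ᶠ w in nhds z, Quaternion.normSq (F w) = sphereQuad z w ^ m * g w := by
  obtain ⟨U, l, K, h1, rfl, h3, h4, h5, h6⟩ := h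
  refine ⟨_, h4.analyticAt_normSq h1.1 h1.2.2, h5.normSq_ne_zero, ?_⟩
  filter_upwards [h1.1.mem_nhds h1.2.2] with w hw
  rw [h6 w hw, map_mul, normSq_linearStemProd h3]

theorem normSq_quotientStem {G H : ℂ → ℍ[ℂ]} {w : ℂ} (h : Quaternion.normSq (G w) ≠ 0) :
    Quaternion.normSq (quotientStem G H w)
      = Quaternion.normSq (H w) / Quaternion.normSq (G w) := by
  rw [quotientStem, normSq_smul_complex, map_mul, Quaternion.normSq_star]
  field_simp

theorem IsLocalQuotient.eventually_symmetrization {f : ℍ → OnePoint ℍ} {z : ℂ} {U : Set ℂ}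
    {G H : ℂ → ℍ[ℂ]} (h : IsLocalQuotient f z U G H) :
    ∀ᶠ w in nhdsWithin z {z}ᶜ, Quaternion.normSq (G w) ≠ 0 ∧
      symmetrization f w = Quaternion.normSq (H w) / Quaternion.normSq (G w) := by
  filter_upwards [eventually_mem_punctured h.nhd.1 h.nhd.2.2 z] with w hw
  refine ⟨h.den_ne_zero w hw, ?_⟩
  rw [symmetrization, stemOf_eq h.induced hw, normSq_quotientStem (h.den_ne_zero w hw)]

theorem IsLocalQuotient.meromorphicAt {f : ℍ → OnePoint ℍ} {z : ℂ} {U : Set ℂ}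
    {G H : ℂ → ℍ[ℂ]} (h : IsLocalQuotient f z U G H) : MeromorphicAt (symmetrization f) z := by
  have h1 := (h.hol_num.analyticAt_normSq h.nhd.1 h.nhd.2.2).meromorphicAt
  have h2 := (h.hol_den.analyticAt_normSq h.nhd.1 h.nhd.2.2).meromorphicAt
  refine (h1.div h2).congr ?_
  filter_upwards [h.eventually_symmetrization] with w hw
  exact hw.2.symm

theorem HasSliceDivisorAt.meromorphicOrderAt_eq {f : ℍ → OnePoint ℍ} {z : ℂ} {k : ℤ}
    (h : HasSliceDivisorAt f z k) :
    meromorphicOrderAt (symmetrization f) z = ((sphereWeight z * k : ℤ) : WithTop ℤ) := by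
  obtain ⟨U, G, H, m, n, hq, hm, hn, rfl⟩ := h
  obtain ⟨g1, a1, b1, c1⟩ := hm.eventuallyEq
  obtain ⟨g2, a2, b2, c2⟩ := hn.eventuallyEq
  refine meromorphicOrderAt_of_sphereQuad (g := fun w => g1 w / g2 w) (a1.div a2 b2)
    (div_ne_zero b1 b2) ?_
  filter_upwards [hq.eventually_symmetrization, nhdsWithin_le_nhds c1, nhdsWithin_le_nhds c2,
    eventually_nhdsNE_notMem_pair z z] with w h1 h2 h3 h4
  rw [h1.2, h2, h3, zpow_sub₀ (sphereQuad_ne_zero h4), zpow_natCast, zpow_natCast]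
  field_simp

theorem IsLocalQuotient.order_den_ne_top {f : ℍ → OnePoint ℍ} {z : ℂ} {U : Set ℂ}
    {G H : ℂ → ℍ[ℂ]} (h : IsLocalQuotient f z U G H) :
    analyticOrderAt (fun w => Quaternion.normSq (G w)) z ≠ ⊤ := by
  intro ht
  rw [analyticOrderAt_eq_top] at ht
  obtain ⟨w, h1, h2⟩ := (h.eventually_symmetrization.and (nhdsWithin_le_nhds ht)).exists
  exact h1.1 h2

theorem IsLocalQuotient.order_num_ne_top {f : ℍ → OnePoint ℍ} {z : ℂ} {U : Set ℂ}
    {G H : ℂ → ℍ[ℂ]} (h : IsLocalQuotient f z U G H)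
    (hN : meromorphicOrderAt (symmetrization f) z ≠ ⊤) :
    analyticOrderAt (fun w => Quaternion.normSq (H w)) z ≠ ⊤ := by
  intro ht
  rw [analyticOrderAt_eq_top] at ht
  apply hN
  rw [meromorphicOrderAt_eq_top_iff]
  filter_upwards [h.eventually_symmetrization, nhdsWithin_le_nhds ht] with w h1 h2
  rw [h1.2, h2, zero_div]

theorem IsLocalQuotient.exists_hasSliceDivisorAt {f : ℍ → OnePoint ℍ} {z : ℂ} {U : Set ℂ}
    {G H : ℂ → ℍ[ℂ]} (h : IsLocalQuotient f z U G H)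
    (hN : meromorphicOrderAt (symmetrization f) z ≠ ⊤) : ∃ k, HasSliceDivisorAt f z k := by
  obtain ⟨l, K, h1, h2, h3, h4⟩ :=
    exists_factorization_of_ne_top h.nhd h.hol_den h.order_den_ne_top
  obtain ⟨l', K', h1', h2', h3', h4'⟩ :=
    exists_factorization_of_ne_top h.nhd h.hol_num (h.order_num_ne_top hN)
  exact ⟨_, U, G, H, _, _, h, ⟨U, l', K', h.nhd, rfl, h1', h2', h3', h4'⟩,
    ⟨U, l, K, h.nhd, rfl, h1, h2, h3, h4⟩, rfl⟩

/-- In `(Gᶜ G)⁻¹ Gᶜ H` the first factor is central. It is a power of `sphereQuad z` times the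
inverse of `normSq K`, with `K` the zero-free part of `G`. It remains to factor `Gᶜ H` as a whole,
which avoids moving linear factors past each other. -/
theorem IsLocalQuotient.exists_hasLocalForm {f : ℍ → OnePoint ℍ} {z : ℂ} {U : Set ℂ}
    {G H : ℂ → ℍ[ℂ]} (h : IsLocalQuotient f z U G H)
    (hN : meromorphicOrderAt (symmetrization f) z ≠ ⊤) : ∃ s l, HasLocalForm f z s l := by
  obtain ⟨l, K, h1, h2, h3, h4⟩ :=
    exists_factorization_of_ne_top h.nhd h.hol_den h.order_den_ne_top
  have hX := h.hol_den.star.mul h.hol_num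
  have hXo : analyticOrderAt (fun w => Quaternion.normSq (star (G w) * H w)) z ≠ ⊤ := by
    have : (fun w => Quaternion.normSq (star (G w) * H w))
        = (fun w => Quaternion.normSq (G w)) * fun w => Quaternion.normSq (H w) := by
      ext w
      simp [Quaternion.normSq_star]
    rw [this, analyticOrderAt_mul (h.hol_den.analyticAt_normSq h.nhd.1 h.nhd.2.2)
      (h.hol_num.analyticAt_normSq h.nhd.1 h.nhd.2.2)]
    exact WithTop.add_ne_top.2 ⟨h.order_den_ne_top, h.order_num_ne_top hN⟩
  obtain ⟨l', K', h1', h2', h3', h4'⟩ := exists_factorization_of_ne_top h.nhd hX hXo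
  have hG : ∀ w ∈ U, Quaternion.normSq (G w)
      = sphereQuad z w ^ l.length * Quaternion.normSq (K w) := fun w hw => by
    rw [h4 w hw, map_mul, normSq_linearStemProd h1]
  -- Holds on all of `U`, not only near `z`: off the sphere by `den_ne_zero`, at `conj z` by the
  -- stem symmetry.
  have hu : ∀ w ∈ U, Quaternion.normSq (K w) ≠ 0 := by
    intro w hw
    by_cases hwz : w ∈ ({z, conj z} : Set ℂ)
    · rcases hwz with rfl | rfl
      · exact h3.normSq_ne_zero
      · rw [h2.normSq_conj z h.nhd.2.2]
        exact (map_ne_zero _).2 h3.normSq_ne_zero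
    · have := h.den_ne_zero w ⟨hw, hwz⟩
      rw [hG w hw] at this
      exact right_ne_zero_of_mul this
  refine ⟨-l.length, l', U, fun w => (Quaternion.normSq (K w))⁻¹ • K' w, h.nhd, ?_, ?_, h1', ?_⟩
  · refine IsHolStem.smul (h2.differentiableOn_normSq.inv hu) (fun w hw => ?_) h2'
    rw [h2.normSq_conj w hw, map_inv₀]
  · intro I hI h0
    have h5 := norm_evalAt_smul hI (Quaternion.normSq (K z))⁻¹ (K' z)
    rw [h0, norm_zero, eq_comm, mul_eq_zero, norm_eq_zero, norm_eq_zero, inv_eq_zero] at h5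
    exact h5.elim h3.normSq_ne_zero (h3' I hI)
  · intro w hw I hI
    rw [h.induced w hw I hI, quotientStem, h4' w hw.1, hG w hw.1]
    beta_reduce
    rw [mul_complex_smul, smul_smul, mul_inv, zpow_neg, zpow_natCast]

/-! ### Uniqueness -/

/-- After cancelling the smaller power of `sphereQuad z`, the two expressions agree at `z` as well.
A reduced product vanishes at most at its head, so no positive power of `sphereQuad z` can remain on
the other side. With equal exponents the zero sets on the sphere agree, hence so do the heads. -/
theorem HasSphericalForm.unique_aux {f : ℍ → OnePoint ℍ} {z : ℂ} (hz : z.im ≠ 0) {m m' : ℤ}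
    {l l' : List ℍ} (h : HasSphericalForm f z m l) (h' : HasSphericalForm f z m' l')
    (hm : m ≤ m') : m = m' ∧ l.head? = l'.head? := by
  obtain ⟨U, K, h1, h2, h3, h4, h5, h6⟩ := h
  obtain ⟨U', K', h1', h2', h3', h4', h5', h6'⟩ := h'
  obtain ⟨d, rfl⟩ := Int.le.dest hm
  have hV := h1.inter h1'
  have hA : IsHolStem (U ∩ U') (fun w => linearStemProd l w * K w) :=
    ((isHolStem_linearStemProd _ l).mul h2).mono Set.inter_subset_left
  have hB : IsHolStem (U ∩ U') (fun w => sphereQuad z w ^ d • (linearStemProd l' w * K' w)) :=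
    IsHolStem.smul ((differentiable_sphereQuad z).pow d).differentiableOn
      (fun w _ => by simp [sphereQuad_conj])
      (((isHolStem_linearStemProd _ l').mul h2').mono Set.inter_subset_right)
  have hAB := hA.eqOn_of_punctured hV.1 (z := z) hB (fun w hw => by
    have e1 := stemOf_eq h6 (w := w) ⟨hw.1.1, hw.2⟩
    have e2 := stemOf_eq h6' (w := w) ⟨hw.1.2, hw.2⟩
    rw [e1] at e2
    change sphereQuad z w ^ m • _ = sphereQuad z w ^ (m + d) • _ at e2
    have hne := sphereQuad_ne_zero hw.2
    rw [zpow_add₀ hne, mul_smul, zpow_natCast] at e2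
    have e3 := congrArg (fun Y => (sphereQuad z w ^ m)⁻¹ • Y) e2
    simpa only [smul_smul, inv_mul_cancel_left₀ (zpow_ne_zero m hne),
      inv_mul_cancel₀ (zpow_ne_zero m hne), one_smul] using e3) z hV.2.2
  have iff1 := fun I (hI : I ∈ imUnits) =>
    evalAt_linearStemProd_mul_eq_zero_iff (K := K z) h3 h4 h5 hI
  have iff2 := fun I (hI : I ∈ imUnits) =>
    evalAt_linearStemProd_mul_eq_zero_iff (K := K' z) h3' h4' h5' hI
  have hd : d = 0 := by
    by_contra hd
    rw [sphereQuad_self, zero_pow hd, zero_complex_smul] at hAB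
    have e1 := (iff1 _ stdUnit_mem).1 (by rw [hAB, evalAt_zero])
    have e2 := (iff1 _ (neg_mem_imUnits stdUnit_mem)).1 (by rw [hAB, evalAt_zero])
    rw [e1, Option.some_inj] at e2
    have e3 := slicePoint_injective_unit hz e2
    have e4 : stdUnit.imI = -stdUnit.imI := by rw [← Quaternion.imI_neg, ← e3]
    norm_num [stdUnit] at e4
  subst hd
  rw [pow_zero, one_smul] at hAB
  refine ⟨by simp, ?_⟩
  have iff3 : ∀ I ∈ imUnits, l.head? = some (slicePoint z I) ↔ l'.head? = some (slicePoint z I) :=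
    fun I hI => by rw [← iff1 I hI, ← iff2 I hI, hAB]
  apply Option.ext
  intro p
  constructor
  · intro hp
    obtain ⟨I, hI, rfl⟩ := h4 p (List.mem_of_mem_head? hp)
    exact (iff3 I hI).1 hp
  · intro hp
    obtain ⟨I, hI, rfl⟩ := h4' p (List.mem_of_mem_head? hp)
    exact (iff3 I hI).2 hp

theorem HasSphericalForm.unique {f : ℍ → OnePoint ℍ} {z : ℂ} (hz : z.im ≠ 0) {m m' : ℤ}
    {l l' : List ℍ} (h : HasSphericalForm f z m l) (h' : HasSphericalForm f z m' l') :
    m = m' ∧ l.head? = l'.head? ∧ l.length = l'.length := by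
  have h1 : m = m' ∧ l.head? = l'.head? := by
    rcases le_total m m' with hm | hm
    · exact h.unique_aux hz h' hm
    · obtain ⟨e1, e2⟩ := h'.unique_aux hz h hm
      exact ⟨e1.symm, e2.symm⟩
  refine ⟨h1.1, h1.2, ?_⟩
  -- The order of the symmetrization fixes `2m + n`, so equal `m` forces equal lengths.
  have h2 := h.hasLocalForm.meromorphicOrderAt_eq
  rw [h'.hasLocalForm.meromorphicOrderAt_eq, h1.1] at h2
  have h3 : sphereWeight z * (2 * m' + l'.length) = sphereWeight z * (2 * m' + l.length) := by
    exact_mod_cast h2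
  have h4 := mul_left_cancel₀ (sphereWeight_pos z).ne' h3
  omega

/-! ### Continuity of slice functions -/

theorem ContinuousOn.quaternion_mk {X : Type*} [TopologicalSpace X] {s : Set X} {g : X → ℍ}
    (h0 : ContinuousOn (fun x => (g x).re) s) (h1 : ContinuousOn (fun x => (g x).imI) s)
    (h2 : ContinuousOn (fun x => (g x).imJ) s) (h3 : ContinuousOn (fun x => (g x).imK) s) :
    ContinuousOn g s := by
  obtain ⟨e1, a1, b1, c1, d1⟩ : ∃ e : ℍ, e.re = 0 ∧ e.imI = 1 ∧ e.imJ = 0 ∧ e.imK = 0 :=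
    ⟨⟨0, 1, 0, 0⟩, rfl, rfl, rfl, rfl⟩
  obtain ⟨e2, a2, b2, c2, d2⟩ : ∃ e : ℍ, e.re = 0 ∧ e.imI = 0 ∧ e.imJ = 1 ∧ e.imK = 0 :=
    ⟨⟨0, 0, 1, 0⟩, rfl, rfl, rfl, rfl⟩
  obtain ⟨e3, a3, b3, c3, d3⟩ : ∃ e : ℍ, e.re = 0 ∧ e.imI = 0 ∧ e.imJ = 0 ∧ e.imK = 1 :=
    ⟨⟨0, 0, 0, 1⟩, rfl, rfl, rfl, rfl⟩
  have : g = fun x => (g x).re • (1 : ℍ) + (g x).imI • e1 + (g x).imJ • e2 + (g x).imK • e3 := by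
    ext x <;> simp [a1, b1, c1, d1, a2, b2, c2, d2, a3, b3, c3, d3]
  rw [this]
  fun_prop

theorem IsHolStem.continuousOn_stemRe {U : Set ℂ} {F : ℂ → ℍ[ℂ]} (hF : IsHolStem U F) :
    ContinuousOn (fun w => stemRe (F w)) U :=
  ContinuousOn.quaternion_mk (Complex.continuous_re.comp_continuousOn hF.diff_re.continuousOn)
    (Complex.continuous_re.comp_continuousOn hF.diff_imI.continuousOn)
    (Complex.continuous_re.comp_continuousOn hF.diff_imJ.continuousOn)
    (Complex.continuous_re.comp_continuousOn hF.diff_imK.continuousOn)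

theorem IsHolStem.continuousOn_stemIm {U : Set ℂ} {F : ℂ → ℍ[ℂ]} (hF : IsHolStem U F) :
    ContinuousOn (fun w => stemIm (F w)) U :=
  ContinuousOn.quaternion_mk (Complex.continuous_im.comp_continuousOn hF.diff_re.continuousOn)
    (Complex.continuous_im.comp_continuousOn hF.diff_imI.continuousOn)
    (Complex.continuous_im.comp_continuousOn hF.diff_imJ.continuousOn)
    (Complex.continuous_im.comp_continuousOn hF.diff_imK.continuousOn)

theorem continuous_upperPoint : Continuous upperPoint := by
  have h : upperPoint = fun q : ℍ => (q.re : ℂ) + (‖q.im‖ : ℂ) * Complex.I := by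
    ext q
    exact (Complex.re_add_im (upperPoint q)).symm
  rw [h]
  have h1 := Quaternion.continuous_re
  have h2 := Quaternion.continuous_im
  fun_prop

theorem continuousAt_unitOf {q : ℍ} (hq : q.im ≠ 0) : ContinuousAt unitOf q := by
  have h2 := Quaternion.continuous_im
  have h1 : ContinuousAt (fun q : ℍ => ‖q.im‖⁻¹ • q.im) q :=
    (h2.norm.continuousAt.inv₀ (norm_ne_zero_iff.2 hq)).smul h2.continuousAt
  refine h1.congr ?_
  filter_upwards [h2.continuousAt.eventually_ne hq] with x hx
  simp [unitOf, hx]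

-- `unitOf` jumps at real points, but there the `ι`-component tends to `0` while `unitOf` keeps norm
-- one, so the product is still continuous.
open Filter Topology in
theorem IsHolStem.tendsto_evalAt {U : Set ℂ} (hU : IsOpen U) {F : ℂ → ℍ[ℂ]} (hF : IsHolStem U F)
    {q : ℍ} (hq : upperPoint q ∈ U) :
    Tendsto (fun x => evalAt (F (upperPoint x)) (unitOf x)) (𝓝 q)
      (𝓝 (evalAt (F (upperPoint q)) (unitOf q))) := by
  have hup : Tendsto upperPoint (𝓝 q) (𝓝 (upperPoint q)) := continuous_upperPoint.continuousAt
  have h1 : Tendsto (fun x => stemRe (F (upperPoint x))) (𝓝 q) (𝓝 (stemRe (F (upperPoint q)))) :=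
    (hF.continuousOn_stemRe.continuousAt (hU.mem_nhds hq)).tendsto.comp hup
  have h2 : Tendsto (fun x => stemIm (F (upperPoint x))) (𝓝 q) (𝓝 (stemIm (F (upperPoint q)))) :=
    (hF.continuousOn_stemIm.continuousAt (hU.mem_nhds hq)).tendsto.comp hup
  refine h1.add ?_
  by_cases hi : q.im = 0
  · have h3 : stemIm (F (upperPoint q)) = 0 := by
      apply stemIm_eq_zero_of_conj_eq hF hq
      rw [Complex.conj_eq_iff_im]
      simp [upperPoint, hi]
    rw [h3] at h2 ⊢
    rw [mul_zero]
    rw [tendsto_zero_iff_norm_tendsto_zero] at h2 ⊢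
    refine h2.congr fun x => ?_
    rw [norm_mul, norm_eq_one_of_mem_imUnits (unitOf_mem x), one_mul]
  · exact (continuousAt_unitOf hi).tendsto.mul h2

theorem InducedOn.apply_eq {U : Set ℂ} {F : ℂ → ℍ[ℂ]} {f : ℍ → OnePoint ℍ} (h : InducedOn U F f)
    {x : ℍ} (hx : upperPoint x ∈ U) :
    f x = ((evalAt (F (upperPoint x)) (unitOf x) : ℍ) : OnePoint ℍ) := by
  have := h _ hx _ (unitOf_mem x)
  rwa [slicePoint_upperPoint] at this

/-- A quaternion has the two presentations `(w, I)` and `(w̄, -I)`, and every unit is allowed if it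
is real; the stem symmetry gives all of them the same value. -/
theorem IsHolStem.evalAt_eq {U : Set ℂ} {F : ℂ → ℍ[ℂ]} (hF : IsHolStem U F)
    {w : ℂ} (hw : w ∈ U) {I : ℍ} (hI : I ∈ imUnits) :
    evalAt (F (upperPoint (slicePoint w I))) (unitOf (slicePoint w I)) = evalAt (F w) I := by
  have key : ∀ J J' : ℍ, slicePoint w J = slicePoint w J' →
      evalAt (F w) J = evalAt (F w) J' := by
    intro J J' h
    by_cases hz : w.im = 0
    · simp [evalAt, stemIm_eq_zero_of_conj_eq hF hw (Complex.conj_eq_iff_im.2 hz)]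
    · rw [slicePoint_injective_unit hz h]
  have h1 := slicePoint_upperPoint (slicePoint w I)
  rcases mem_sphereOf_iff_upperPoint.1 (⟨I, hI, rfl⟩ : slicePoint w I ∈ sphereOf w) with h | h
  · rw [h] at h1 ⊢
    exact key _ _ h1
  · rw [h] at h1 ⊢
    rw [hF.stem w hw, evalAt_complexConj]
    rw [slicePoint_conj] at h1
    exact key _ _ h1

open Filter Topology in
theorem eventually_upperPoint_mem_punctured {U : Set ℂ} {z : ℂ} (hU : IsSymmNhd U z) {q : ℍ}
    (hq : q ∈ sphereOf z) :
    ∀ᶠ x in 𝓝[(sphereOf z)ᶜ] q, upperPoint x ∈ U \ {z, conj z} := by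
  have h1 : upperPoint q ∈ U := by
    rcases mem_sphereOf_iff_upperPoint.1 hq with h | h
    · exact h ▸ hU.2.2
    · exact h ▸ hU.conj_mem
  have h2 : ∀ᶠ x in 𝓝[(sphereOf z)ᶜ] q, upperPoint x ∈ U :=
    nhdsWithin_le_nhds (continuous_upperPoint.continuousAt.eventually (hU.1.mem_nhds h1))
  filter_upwards [h2, self_mem_nhdsWithin] with x hx hx'
  refine ⟨hx, fun h => hx' (mem_sphereOf_iff_upperPoint.2 ?_)⟩
  simpa using h

/-- A semi-regular function that is induced by a stem function off `𝕊_z` is so on `𝕊_z`. -/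
theorem IsSemiRegular.inducedOn {D : Set ℂ} {f : ℍ → OnePoint ℍ} (hf : IsSemiRegular D f) {z : ℂ}
    (hz : z ∈ D) {U : Set ℂ} (hU : IsSymmNhd U z) {F : ℂ → ℍ[ℂ]} (hF : IsHolStem U F)
    (h : InducedOn (U \ {z, conj z}) F f) : InducedOn U F f := by
  intro w hw I hI
  by_cases hwz : w ∈ ({z, conj z} : Set ℂ)
  · have hq : slicePoint w I ∈ sphereOf z := by
      rcases hwz with rfl | rfl
      · exact ⟨I, hI, rfl⟩
      · rw [← sphereOf_conj]
        exact ⟨I, hI, rfl⟩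
    have hqU : upperPoint (slicePoint w I) ∈ U := by
      rcases mem_sphereOf_iff_upperPoint.1 hq with h | h
      · exact h ▸ hU.2.2
      · exact h ▸ hU.conj_mem
    rw [← hF.evalAt_eq hw hI]
    refine hf.value_eq_limit z hz _ hq _ ?_
    have h1 := (hF.tendsto_evalAt hU.1 hqU).mono_left
      (nhdsWithin_le_nhds (s := (sphereOf z)ᶜ))
    refine ((OnePoint.continuous_coe.tendsto _).comp h1).congr' ?_
    filter_upwards [eventually_upperPoint_mem_punctured hU hq] with x hx
    exact (h.apply_eq hx).symm
  · exact h w ⟨hw, hwz⟩ I hI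

open Filter Topology in
/-- A semi-regular function is infinite at the points where its absolute value tends to
infinity. -/
theorem IsSemiRegular.eq_infty {D : Set ℂ} {f : ℍ → OnePoint ℍ} (hf : IsSemiRegular D f) {z : ℂ}
    (hz : z ∈ D) (hzi : 0 ≤ z.im) {U : Set ℂ} (hU : IsSymmNhd U z) {F : ℂ → ℍ[ℂ]}
    (hF : IsHolStem U F) {c : ℂ → ℂ} (hc : Tendsto (fun w => ‖c w‖) (𝓝[≠] z) atTop)
    (h : InducedOn (U \ {z, conj z}) (fun w => c w • F w) f) {I : ℍ} (hI : I ∈ imUnits)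
    (h0 : evalAt (F z) I ≠ 0) : f (slicePoint z I) = OnePoint.infty := by
  have hq : slicePoint z I ∈ sphereOf z := ⟨I, hI, rfl⟩
  have hqz : upperPoint (slicePoint z I) = z := upperPoint_eq_of_mem_sphereOf hzi hq
  have hqU : upperPoint (slicePoint z I) ∈ U := by
    rw [hqz]
    exact hU.2.2
  refine hf.value_eq_limit z hz _ hq _ ?_
  have h1 := ((hF.tendsto_evalAt hU.1 hqU).mono_left
      (nhdsWithin_le_nhds (s := (sphereOf z)ᶜ))).norm
  rw [hF.evalAt_eq hU.2.2 hI] at h1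
  have hev := eventually_upperPoint_mem_punctured hU hq
  have h2 : Tendsto upperPoint (𝓝[(sphereOf z)ᶜ] slicePoint z I) (𝓝[≠] z) := by
    refine tendsto_nhdsWithin_iff.2 ⟨?_, ?_⟩
    · have := continuous_upperPoint.continuousAt (x := slicePoint z I)
      unfold ContinuousAt at this
      rw [hqz] at this
      exact this.mono_left nhdsWithin_le_nhds
    · filter_upwards [hev] with x hx hx'
      exact hx.2 (by rw [hx']; simp)
  have h3 := (hc.comp h2).atTop_mul_pos (norm_pos_iff.2 h0) h1
  have h4 : Tendsto (fun x => c (upperPoint x) • F (upperPoint x) |> fun X => evalAt X (unitOf x))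
      (𝓝[(sphereOf z)ᶜ] slicePoint z I) (coclosedCompact ℍ) := by
    rw [coclosedCompact_eq_cocompact, ← Metric.cobounded_eq_cocompact,
      ← tendsto_norm_atTop_iff_cobounded]
    refine h3.congr fun x => ?_
    rw [norm_evalAt_smul (unitOf_mem x)]
    rfl
  refine (OnePoint.tendsto_coe_infty.comp h4).congr' ?_
  filter_upwards [hev] with x hx
  exact (h.apply_eq hx).symm

open Filter Topology in
theorem tendsto_norm_zpow_atTop {g : ℂ → ℂ} (hg : Continuous g) {z : ℂ} (h0 : g z = 0)
    (hne : ∀ᶠ w in 𝓝[≠] z, g w ≠ 0) {m : ℤ} (hm : m < 0) :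
    Tendsto (fun w => ‖g w ^ m‖) (𝓝[≠] z) atTop := by
  have h1 : Tendsto g (𝓝[≠] z) (𝓝[≠] 0) := by
    refine tendsto_nhdsWithin_iff.2 ⟨?_, hne⟩
    have := hg.continuousAt (x := z)
    unfold ContinuousAt at this
    rw [h0] at this
    exact this.mono_left nhdsWithin_le_nhds
  obtain ⟨n, rfl⟩ := Int.eq_negSucc_of_lt_zero hm
  have h2 := (tendsto_pow_atTop (α := ℝ) n.succ_ne_zero).comp
    ((tendsto_norm_cobounded_atTop.comp tendsto_inv₀_nhdsNE_zero).comp h1)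
  refine h2.congr fun w => ?_
  simp [zpow_negSucc]

/-- A semi-regular function without poles on the sphere `𝕊_z` is slice regular near it. -/
theorem IsSemiRegular.exists_inducedOn {D : Set ℂ} {f : ℍ → OnePoint ℍ} (hf : IsSemiRegular D f)
    {z : ℂ} (hz : z ∈ D) (hzi : 0 ≤ z.im) {s : ℤ} {l : List ℍ} (hl : HasLocalForm f z s l)
    (hfin : ∀ q ∈ sphereOf z, f q ≠ OnePoint.infty) :
    ∃ (U : Set ℂ) (F : ℂ → ℍ[ℂ]), IsSymmNhd U z ∧ IsHolStem U F ∧ InducedOn U F f := by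
  rcases hzi.eq_or_lt' with h0 | hpos
  · obtain ⟨x, rfl⟩ := Complex.conj_eq_iff_real.1 (Complex.conj_eq_iff_im.2 h0)
    obtain ⟨U, K, h1, h2, h3, h4⟩ := hl.hasRealOrder
    set k := 2 * s + (l.length : ℤ)
    have h4' : InducedOn (U \ {(x : ℂ), conj (x : ℂ)}) (fun w => ((w - (x : ℂ)) ^ k) • K w) f := by
      simpa using h4
    -- A negative exponent would make `|f|` tend to infinity at `x`, and then `f` takes the value
    -- `∞` there.
    have hk : 0 ≤ k := by
      by_contra hk
      have htop := tendsto_norm_zpow_atTop (g := fun w => w - (x : ℂ)) (z := x) (by fun_prop)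
        (by simp) ((eventually_nhdsNE_ne _ (x : ℂ)).mono fun w hw => sub_ne_zero.2 hw)
        (not_le.1 hk)
      exact hfin _ ⟨stdUnit, stdUnit_mem, rfl⟩
        (hf.eq_infty hz hzi h1 h2 htop h4' stdUnit_mem (h3 _ stdUnit_mem))
    obtain ⟨n, hn⟩ := Int.eq_ofNat_of_zero_le hk
    have hF : IsHolStem U (fun w => ((w - (x : ℂ)) ^ n) • K w) :=
      IsHolStem.smul (by fun_prop) (fun w _ => by simp) h2
    refine ⟨U, _, h1, hF, hf.inducedOn hz h1 hF ?_⟩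
    simpa only [hn, zpow_natCast] using h4'
  · obtain ⟨m, l', U, K, h1, h2, h3, h4, h5, h6⟩ := hl.exists_hasSphericalForm
    have hA : IsHolStem U (fun w => linearStemProd l' w * K w) :=
      (isHolStem_linearStemProd _ l').mul h2
    have hm : 0 ≤ m := by
      by_contra hm
      have htop := tendsto_norm_zpow_atTop (g := sphereQuad z) (z := z)
        (differentiable_sphereQuad z).continuous (sphereQuad_self z)
        ((eventually_nhdsNE_notMem_pair z z).mono fun w hw => sphereQuad_ne_zero hw)
        (not_le.1 hm)
      -- The reduced product vanishes at most at one point of the sphere, so at one of two opposite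
      -- points the pole is not compensated.
      have hex : ∃ I ∈ imUnits, evalAt (linearStemProd l' z * K z) I ≠ 0 := by
        by_contra hcon
        push Not at hcon
        have e1 := (evalAt_linearStemProd_mul_eq_zero_iff (K := K z) h3 h4 h5 stdUnit_mem).1
          (hcon _ stdUnit_mem)
        have e2 := (evalAt_linearStemProd_mul_eq_zero_iff (K := K z) h3 h4 h5
          (neg_mem_imUnits stdUnit_mem)).1 (hcon _ (neg_mem_imUnits stdUnit_mem))
        rw [e1, Option.some_inj] at e2
        have e3 := slicePoint_injective_unit hpos.ne' e2
        have e4 : stdUnit.imI = -stdUnit.imI := by rw [← Quaternion.imI_neg, ← e3]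
        norm_num [stdUnit] at e4
      obtain ⟨I, hI, hI0⟩ := hex
      exact hfin _ ⟨I, hI, rfl⟩ (hf.eq_infty hz hzi h1 hA htop h6 hI hI0)
    obtain ⟨n, rfl⟩ := Int.eq_ofNat_of_zero_le hm
    have hF : IsHolStem U (fun w => (sphereQuad z w ^ n) • (linearStemProd l' w * K w)) :=
      IsHolStem.smul ((differentiable_sphereQuad z).pow n).differentiableOn
        (fun w _ => by simp [sphereQuad_conj]) hA
    refine ⟨U, _, h1, hF, hf.inducedOn hz h1 hF ?_⟩
    intro w hw I hI
    rw [h6 w hw I hI]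
    beta_reduce
    rw [zpow_natCast]
    rfl

open Filter Topology in
/-- The local form is trivial off a discrete set. -/
theorem HasLocalForm.eventually_trivial {f : ℍ → OnePoint ℍ} {z : ℂ} {s : ℤ} {l : List ℍ}
    (h : HasLocalForm f z s l) : ∀ᶠ w in 𝓝[≠] z, HasLocalForm f w 0 [] := by
  obtain ⟨U, K, h1, h2, h3, h4, h6⟩ := h
  -- On `V` the whole local expression, power included, is holomorphic and zero-free, so it can
  -- serve as the factor `g`.
  set V : Set ℂ := (U ∩ {u | Quaternion.normSq (K u) ≠ 0}) \ {z, conj z} with hV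
  have hVo : IsOpen V := by
    refine IsOpen.sdiff ?_ (Set.toFinite _).isClosed
    exact h2.differentiableOn_normSq.continuousOn.isOpen_inter_preimage h1.1 isOpen_ne
  have hVs : IsSymmetricSet V := by
    intro w hw
    refine ⟨⟨h1.2.1 w hw.1.1, ?_⟩, ?_⟩
    · change Quaternion.normSq (K (conj w)) ≠ 0
      rw [h2.normSq_conj w hw.1.1]
      exact (map_ne_zero _).2 hw.1.2
    · intro hc
      apply hw.2
      rcases hc with hc | hc
      · right
        rw [Set.mem_singleton_iff, ← hc, Complex.conj_conj]
      · left
        exact (starRingEnd ℂ).injective hc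
  have hVU : V ⊆ U := fun w hw => hw.1.1
  have hF : IsHolStem V (fun w => sphereQuad z w ^ s • (linearStemProd l w * K w)) := by
    refine IsHolStem.smul ?_ (fun w _ => by rw [sphereQuad_conj, map_zpow₀])
      (((isHolStem_linearStemProd _ l).mul h2).mono hVU)
    exact (differentiable_sphereQuad z).differentiableOn.zpow
      (Or.inl fun w hw => sphereQuad_ne_zero hw.2)
  have hev : ∀ᶠ w in 𝓝 z, Quaternion.normSq (K w) ≠ 0 :=
    (h2.analyticAt_normSq h1.1 h1.2.2).continuousAt.eventually_ne h3.normSq_ne_zero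
  filter_upwards [eventually_mem_punctured h1.1 h1.2.2 z, nhdsWithin_le_nhds hev] with w hw hw'
  refine ⟨V, _, ⟨hVo, hVs, ⟨hw.1, hw'⟩, hw.2⟩, hF, ?_, by simp, ?_⟩
  · apply normSq_ne_zero_iff.1
    rw [normSq_localForm h4 s hw.2]
    exact mul_ne_zero (zpow_ne_zero _ (sphereQuad_ne_zero hw.2)) hw'
  · intro u hu I hI
    rw [h6 u ⟨hu.1.1.1, hu.1.2⟩ I hI]
    beta_reduce
    rw [zpow_zero, one_smul, linearStemProd_nil, one_mul]

/-! ### Values of the multiplicities -/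

theorem upperPoint_ofReal (x : ℝ) : upperPoint (x : ℍ) = x := by
  rw [← slicePoint_ofReal x stdUnit]
  refine upperPoint_eq_of_mem_sphereOf (by simp) ⟨stdUnit, stdUnit_mem, rfl⟩

theorem eq_ofReal_of_upperPoint_eq {p : ℍ} {x : ℝ} (h : upperPoint p = x) : p = (x : ℍ) := by
  rw [← slicePoint_upperPoint p, h, slicePoint_ofReal]

theorem HasSliceDivisorAt.sliceDivisor_eq {f : ℍ → OnePoint ℍ} {z : ℂ} {k : ℤ}
    (h : HasSliceDivisorAt f z k) : sliceDivisor f z = k := by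
  refine numberWith_eq (Or.inl h) fun b hb => ?_
  have h1 := hb.meromorphicOrderAt_eq
  rw [h.meromorphicOrderAt_eq] at h1
  exact (mul_left_cancel₀ (sphereWeight_pos z).ne' (by exact_mod_cast h1)).symm

theorem HasRealOrder.unique {f : ℍ → OnePoint ℍ} {x : ℝ} {k k' : ℤ} (h : HasRealOrder f x k)
    (h' : HasRealOrder f x k') : k' = k := by
  have h1 := h'.meromorphicOrderAt_eq
  rw [h.meromorphicOrderAt_eq] at h1
  have h2 : 2 * k = 2 * k' := by exact_mod_cast h1
  omega

theorem HasRealOrder.punctualZeroMult_eq {f : ℍ → OnePoint ℍ} {x : ℝ} {k : ℤ}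
    (h : HasRealOrder f x k) : punctualZeroMult f (x : ℍ) = k.toNat := by
  refine numberWith_eq (Or.inl (Or.inl ⟨x, k, rfl, h, rfl⟩)) fun b hb => ?_
  rcases hb with ⟨x', k', hx, h', rfl⟩ | ⟨z, m, l, hz, h', hl, rfl⟩
  · obtain rfl := Quaternion.coe_injective hx
    rw [h.unique h']
  · obtain ⟨-, -, -, -, -, hmem, -⟩ := h'
    have h1 := upperPoint_eq_of_mem_sphereOf hz.le (hmem _ (List.mem_of_mem_head? hl))
    rw [upperPoint_ofReal] at h1
    rw [← h1] at hz
    simp at hz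

theorem HasRealOrder.realPoleMult_eq {f : ℍ → OnePoint ℍ} {x : ℝ} {k : ℤ}
    (h : HasRealOrder f x k) : realPoleMult f x = (-k).toNat := by
  refine numberWith_eq (Or.inl ⟨k, h, rfl⟩) fun b hb => ?_
  obtain ⟨k', h', rfl⟩ := hb
  rw [h.unique h']

open Classical in
theorem HasSphericalForm.punctualZeroMult_eq {f : ℍ → OnePoint ℍ} {z : ℂ} (hz : 0 < z.im) {m : ℤ}
    {l : List ℍ} (h : HasSphericalForm f z m l) {p : ℍ} (hp : upperPoint p = z) :
    punctualZeroMult f p = if l.head? = some p then l.length else 0 := by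
  refine numberWith_eq ?_ fun b hb => ?_
  · split_ifs with hl
    · exact Or.inl (Or.inr ⟨z, m, l, hz, h, hl, rfl⟩)
    · exact Or.inr rfl
  · rcases hb with ⟨x, k, rfl, -, -⟩ | ⟨z', m', l', hz', h', hl, rfl⟩
    · rw [upperPoint_ofReal] at hp
      rw [← hp] at hz
      simp at hz
    · have hmem := h'
      obtain ⟨-, -, -, -, -, hmem, -⟩ := hmem
      have h1 := upperPoint_eq_of_mem_sphereOf hz'.le (hmem _ (List.mem_of_mem_head? hl))
      rw [hp] at h1
      subst h1
      obtain ⟨-, e1, e2⟩ := h.unique hz.ne' h'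
      rw [e1, hl, e2, if_pos rfl]

theorem HasSphericalForm.sphericalZeroMult_eq {f : ℍ → OnePoint ℍ} {z : ℂ} (hz : 0 < z.im) {m : ℤ}
    {l : List ℍ} (h : HasSphericalForm f z m l) : sphericalZeroMult f z = m.toNat := by
  refine numberWith_eq (Or.inl ⟨m, l, h, rfl⟩) fun b hb => ?_
  obtain ⟨m', l', h', rfl⟩ := hb
  rw [(h.unique hz.ne' h').1]

theorem HasSphericalForm.sphericalPoleMult_eq {f : ℍ → OnePoint ℍ} {z : ℂ} (hz : 0 < z.im) {m : ℤ}
    {l : List ℍ} (h : HasSphericalForm f z m l) : sphericalPoleMult f z = (-m).toNat := by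
  refine numberWith_eq (Or.inl ⟨m, l, h, rfl⟩) fun b hb => ?_
  obtain ⟨m', l', h', rfl⟩ := hb
  rw [(h.unique hz.ne' h').1]

/-! ### Semi-regular functions on a ball -/

theorem closedBall_subset_of_circularization {D : Set ℂ} (hD : IsSymmetricSet D) {ρ : ℝ}
    (hball : Metric.closedBall (0 : ℍ) ρ ⊆ circularization D) :
    Metric.closedBall (0 : ℂ) ρ ⊆ D := by
  intro z hz
  have h1 : slicePoint z stdUnit ∈ Metric.closedBall (0 : ℍ) ρ := by
    rw [mem_closedBall_zero_iff] at hz ⊢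
    rwa [norm_slicePoint stdUnit_mem]
  obtain ⟨w, hw, I, hI, he⟩ := hball h1
  have h2 := upperPoint_slicePoint stdUnit_mem z
  rw [he, upperPoint_slicePoint hI] at h2
  rcases upperPoint_eq_or h2 with h | h
  · exact h ▸ hw
  · rw [← Complex.conj_conj z, ← h]
    exact hD w hw

theorem normSq_of_stemIm_eq_zero {X : ℍ[ℂ]} (h : stemIm X = 0) :
    Quaternion.normSq X = ((‖stemRe X‖ ^ 2 : ℝ) : ℂ) := by
  rw [sq, ← Quaternion.normSq_eq_norm_mul_self, Quaternion.normSq_def', Quaternion.normSq_def']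
  have h0 : X.re.im = 0 := by rw [← stemIm_re, h]; rfl
  have h1 : X.imI.im = 0 := by rw [← stemIm_imI, h]; rfl
  have h2 : X.imJ.im = 0 := by rw [← stemIm_imJ, h]; rfl
  have h3 : X.imK.im = 0 := by rw [← stemIm_imK, h]; rfl
  apply Complex.ext <;> simp [sq, h0, h1, h2, h3]

open Filter Topology in
theorem eventually_eq_zero_of_real {g : ℂ → ℂ} (hg : AnalyticAt ℂ g 0)
    (h : ∀ᶠ w in 𝓝[≠] (0 : ℂ), w.im = 0 → g w = 0) : ∀ᶠ w in 𝓝 (0 : ℂ), g w = 0 := by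
  have ht : Tendsto (fun t : ℝ => (t : ℂ)) (𝓝[≠] 0) (𝓝[≠] 0) := by
    refine tendsto_nhdsWithin_iff.2 ⟨?_, ?_⟩
    · have := Complex.continuous_ofReal.tendsto 0
      rw [Complex.ofReal_zero] at this
      exact this.mono_left nhdsWithin_le_nhds
    · filter_upwards [self_mem_nhdsWithin] with t ht
      simpa using ht
  have h1 : ∃ᶠ t : ℝ in 𝓝[≠] 0, g (t : ℂ) = 0 :=
    ((ht.eventually h).mono fun t ht => ht (Complex.ofReal_im t)).frequently
  exact hg.frequently_zero_iff_eventually_zero.1 (ht.frequently h1)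

open Filter Topology in
/-- The symmetrization of a semi-regular function that is not zero at `0` is not identically zero
near `0`. -/
theorem IsSemiRegular.order_zero_ne_top {D : Set ℂ} {f : ℍ → OnePoint ℍ}
    (hf : IsSemiRegular D f) (hD : (0 : ℂ) ∈ D) (hf0 : f 0 ≠ ((0 : ℍ) : OnePoint ℍ)) :
    meromorphicOrderAt (symmetrization f) 0 ≠ ⊤ := by
  intro htop
  obtain ⟨U, -, G, H, h⟩ := hf.local_quotient 0 hD
  have hH := h.hol_num
  have hU := h.nhd
  rw [meromorphicOrderAt_eq_top_iff] at htop
  -- On the real axis the symmetrization of `H` is `|H₁|²`, which vanishes only with `H`; for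
  -- general stem values it can vanish without `H` doing so.
  have hz : ∀ᶠ w in 𝓝[≠] (0 : ℂ), w.im = 0 → H w = 0 := by
    filter_upwards [htop, h.eventually_symmetrization, nhdsWithin_le_nhds (hU.1.mem_nhds hU.2.2)]
      with w h1 h2 h3 him
    have h4 : Quaternion.normSq (H w) = 0 := by
      rw [h1, eq_comm, div_eq_zero_iff] at h2
      exact h2.2.resolve_right h2.1
    have h5 := stemIm_eq_zero_of_conj_eq hH h3 (Complex.conj_eq_iff_im.2 him)
    rw [normSq_of_stemIm_eq_zero h5] at h4
    apply stem_ext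
    · rw [stemRe_zero]
      simpa using h4
    · rw [h5, stemIm_zero]
  have hn := hU.1.mem_nhds hU.2.2
  have h0 := eventually_eq_zero_of_real (hH.diff_re.analyticAt hn)
    (hz.mono fun w hw hi => by rw [hw hi]; rfl)
  have h1 := eventually_eq_zero_of_real (hH.diff_imI.analyticAt hn)
    (hz.mono fun w hw hi => by rw [hw hi]; rfl)
  have h2 := eventually_eq_zero_of_real (hH.diff_imJ.analyticAt hn)
    (hz.mono fun w hw hi => by rw [hw hi]; rfl)
  have h3 := eventually_eq_zero_of_real (hH.diff_imK.analyticAt hn)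
    (hz.mono fun w hw hi => by rw [hw hi]; rfl)
  have hev : ∀ᶠ w in 𝓝 (0 : ℂ), w ∈ U ∧ H w = 0 := by
    filter_upwards [hn, h0, h1, h2, h3] with w hw a0 a1 a2 a3
    exact ⟨hw, by ext1 <;> assumption⟩
  obtain ⟨ε, hε, hball⟩ := Metric.eventually_nhds_iff_ball.1 hev
  have hV : IsSymmNhd (Metric.ball (0 : ℂ) ε) 0 := by
    refine ⟨Metric.isOpen_ball, fun w hw => ?_, Metric.mem_ball_self hε⟩
    rw [mem_ball_zero_iff] at hw ⊢
    rwa [RCLike.norm_conj]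
  have hZ : IsHolStem (Metric.ball (0 : ℂ) ε) (fun _ => 0) :=
    ⟨fun w _ => by ext <;> simp, by simp, by simp, by simp, by simp⟩
  -- By the identity theorem `H` vanishes near `0`, so `f` is zero off `0`; its value at `0` is the
  -- limit, against `hf0`.
  have hind := hf.inducedOn hD hV hZ (fun w hw I hI => by
    rw [h.induced w ⟨(hball w hw.1).1, hw.2⟩ I hI]
    congr 2
    rw [quotientStem, (hball w hw.1).2]
    ext <;> simp)
  apply hf0
  have := hind 0 hV.2.2 stdUnit stdUnit_mem
  rw [evalAt_zero] at this
  simpa [slicePoint] using this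

theorem IsSymmNhd.conj {U : Set ℂ} {z : ℂ} (h : IsSymmNhd U (conj z)) : IsSymmNhd U z :=
  ⟨h.1, h.2.1, by simpa using h.conj_mem⟩

theorem IsSemiRegular.exists_hasLocalForm {D : Set ℂ} {f : ℍ → OnePoint ℍ}
    (hf : IsSemiRegular D f) {z : ℂ} (hz : z ∈ D)
    (hN : meromorphicOrderAt (symmetrization f) z ≠ ⊤) : ∃ s l, HasLocalForm f z s l := by
  obtain ⟨U, -, G, H, h⟩ := hf.local_quotient z hz
  exact h.exists_hasLocalForm hN

theorem IsSemiRegular.meromorphicAt {D : Set ℂ} {f : ℍ → OnePoint ℍ}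
    (hf : IsSemiRegular D f) {z : ℂ} (hz : z ∈ D) : MeromorphicAt (symmetrization f) z := by
  obtain ⟨U, -, G, H, h⟩ := hf.local_quotient z hz
  exact h.meromorphicAt

theorem IsSemiRegular.order_ne_top {D : Set ℂ} {f : ℍ → OnePoint ℍ} (hf : IsSemiRegular D f)
    {ρ : ℝ} (hρ : 0 < ρ) (hball : Metric.closedBall (0 : ℂ) ρ ⊆ D)
    (hf0 : f 0 ≠ ((0 : ℍ) : OnePoint ℍ)) {z : ℂ} (hz : z ∈ Metric.closedBall (0 : ℂ) ρ) :
    meromorphicOrderAt (symmetrization f) z ≠ ⊤ := by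
  have h0 : (0 : ℂ) ∈ Metric.closedBall (0 : ℂ) ρ := Metric.mem_closedBall_self hρ.le
  exact MeromorphicOn.meromorphicOrderAt_ne_top_of_isPreconnected
    (fun w hw => hf.meromorphicAt (hball hw))
    (convex_closedBall _ _).isPreconnected h0 hz (hf.order_zero_ne_top (hball h0) hf0)

theorem IsSemiRegular.exists_inducedOn_of_order {D : Set ℂ} {f : ℍ → OnePoint ℍ}
    (hf : IsSemiRegular D f) (hD : IsSymmetricSet D) {z : ℂ} (hz : z ∈ D)
    (hN : meromorphicOrderAt (symmetrization f) z ≠ ⊤)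
    (hN' : meromorphicOrderAt (symmetrization f) (conj z) ≠ ⊤)
    (hfin : ∀ q ∈ sphereOf z, f q ≠ OnePoint.infty) :
    ∃ (U : Set ℂ) (F : ℂ → ℍ[ℂ]), IsSymmNhd U z ∧ IsHolStem U F ∧ InducedOn U F f := by
  rcases le_total 0 z.im with hi | hi
  · obtain ⟨s, l, h⟩ := hf.exists_hasLocalForm hz hN
    exact hf.exists_inducedOn hz hi h hfin
  · obtain ⟨s, l, h⟩ := hf.exists_hasLocalForm (hD z hz) hN'
    obtain ⟨U, F, h1, h2, h3⟩ := hf.exists_inducedOn (hD z hz) (by simpa using hi) h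
      (by rwa [sphereOf_conj])
    exact ⟨U, F, h1.conj, h2, h3⟩

/-! ### The boundary integral -/

/-- `log |f|` at the point `ρ cos θ + ρ sin θ I`. -/
def logAbsOn (f : ℍ → OnePoint ℍ) (ρ : ℝ) (t : ℝ × imUnits) : ℝ :=
  Real.log (finiteAbs (f (((ρ * Real.cos t.1 : ℝ) : ℍ) + (ρ * Real.sin t.1) • (t.2 : ℍ))))

theorem logAbsOn_eq (f : ℍ → OnePoint ℍ) (ρ θ : ℝ) (I : imUnits) :
    logAbsOn f ρ (θ, I) = Real.log (finiteAbs (f (slicePoint (circleMap 0 ρ θ) I))) := by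
  have h1 : (circleMap 0 ρ θ).re = ρ * Real.cos θ := by simp [circleMap, Complex.exp_ofReal_mul_I_re]
  have h2 : (circleMap 0 ρ θ).im = ρ * Real.sin θ := by simp [circleMap, Complex.exp_ofReal_mul_I_im]
  simp only [logAbsOn, slicePoint, h1, h2]

instance : BorelSpace imUnits := ⟨rfl⟩

/-- The semi-regular function `f` is slice regular and nowhere zero near the sphere of radius
`ρ`. -/
def RegularOnSphere (f : ℍ → OnePoint ℍ) (ρ : ℝ) : Prop :=
  ∀ z : ℂ, ‖z‖ = ρ → ∃ (U : Set ℂ) (F : ℂ → ℍ[ℂ]), IsSymmNhd U z ∧ IsHolStem U F ∧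
    InducedOn U F f ∧ NonvanishingOnSphere F z

theorem continuous_logAbsOn {f : ℍ → OnePoint ℍ} {ρ : ℝ} (hρ : 0 < ρ) (h : RegularOnSphere f ρ) :
    Continuous (logAbsOn f ρ) := by
  rw [continuous_iff_continuousAt]
  rintro ⟨θ, I⟩
  obtain ⟨U, F, h1, h2, h3, h4⟩ := h (circleMap 0 ρ θ) (by simp [abs_of_pos hρ])
  have hc : ContinuousAt (fun t : ℝ × imUnits => circleMap 0 ρ t.1) (θ, I) :=
    ((continuous_circleMap 0 ρ).comp continuous_fst).continuousAt
  have hU : U ∈ nhds (circleMap 0 ρ θ) := h1.1.mem_nhds h1.2.2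
  have e1 : ContinuousAt (fun t : ℝ × imUnits => stemRe (F (circleMap 0 ρ t.1))) (θ, I) :=
    ContinuousAt.comp (f := fun t : ℝ × imUnits => circleMap 0 ρ t.1)
      (g := fun w => stemRe (F w)) (h2.continuousOn_stemRe.continuousAt hU) hc
  have e2 : ContinuousAt (fun t : ℝ × imUnits => stemIm (F (circleMap 0 ρ t.1))) (θ, I) :=
    ContinuousAt.comp (f := fun t : ℝ × imUnits => circleMap 0 ρ t.1)
      (g := fun w => stemIm (F w)) (h2.continuousOn_stemIm.continuousAt hU) hc
  have e3 : ContinuousAt (fun t : ℝ × imUnits => evalAt (F (circleMap 0 ρ t.1)) t.2) (θ, I) :=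
    e1.add ((continuous_subtype_val.comp continuous_snd).continuousAt.mul e2)
  have e4 := e3.norm.log (norm_ne_zero_iff.2 (h4 I I.2))
  refine e4.congr ?_
  filter_upwards [hc.eventually hU] with t ht
  rw [← Prod.mk.eta (p := t), logAbsOn_eq, h3 _ ht _ t.2.2, finiteAbs_coe]

theorem isCompact_imUnits : IsCompact imUnits := by
  refine Metric.isCompact_of_isClosed_isBounded ?_ ?_
  · exact isClosed_eq (continuous_id.mul continuous_id) continuous_const
  · refine (Metric.isBounded_closedBall (x := (0 : ℍ)) (r := 1)).subset fun I hI => ?_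
    rw [mem_closedBall_zero_iff, norm_eq_one_of_mem_imUnits hI]

open MeasureTheory in
theorem integrable_logAbsOn {f : ℍ → OnePoint ℍ} {ρ : ℝ} (hρ : 0 < ρ) (h : RegularOnSphere f ρ)
    (μ : Measure imUnits) [IsProbabilityMeasure μ] :
    Integrable (logAbsOn f ρ) ((volume.restrict (Set.Ioc (0 : ℝ) (2 * Real.pi))).prod μ) := by
  have hc := continuous_logAbsOn hρ h
  have : CompactSpace imUnits := isCompact_iff_compactSpace.1 isCompact_imUnits
  obtain ⟨C, hC⟩ := ((isCompact_Icc (a := (0 : ℝ)) (b := 2 * Real.pi)).prod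
    (isCompact_univ (X := imUnits))).exists_bound_of_continuousOn hc.continuousOn
  refine Integrable.of_bound hc.aestronglyMeasurable C ?_
  have h1 : (volume.restrict (Set.Ioc (0 : ℝ) (2 * Real.pi))).prod μ
      = (volume.prod μ).restrict (Set.Ioc (0 : ℝ) (2 * Real.pi) ×ˢ Set.univ) := by
    rw [← Measure.prod_restrict, Measure.restrict_univ]
  rw [h1]
  filter_upwards [ae_restrict_mem (measurableSet_Ioc.prod MeasurableSet.univ)] with t ht
  exact hC t ⟨Set.Ioc_subset_Icc_self ht.1, Set.mem_univ _⟩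

/-- The logarithm of `norm_normSq_le`: the angle `2π - θ` gives the conjugate point, whose slice at
`I` is the slice of the original point at `-I`. -/
theorem log_norm_symmetrization_le {f : ℍ → OnePoint ℍ} {ρ : ℝ} (hρ : 0 < ρ)
    (h : RegularOnSphere f ρ) (θ : ℝ) (I : imUnits) :
    Real.log ‖symmetrization f (circleMap 0 ρ θ)‖
      ≤ logAbsOn f ρ (θ, I) + logAbsOn f ρ (2 * Real.pi - θ, I) := by
  obtain ⟨U, F, h1, h2, h3, h4⟩ := h (circleMap 0 ρ θ) (by simp [abs_of_pos hρ])
  have hconj : circleMap 0 ρ (2 * Real.pi - θ) = conj (circleMap 0 ρ θ) := by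
    have : (((2 * Real.pi - θ : ℝ)) : ℂ) * Complex.I
        = -(θ * Complex.I) + 2 * Real.pi * Complex.I := by
      push_cast
      ring
    rw [circleMap, circleMap, this, Complex.exp_periodic, map_add, map_mul, ← Complex.exp_conj]
    simp
  rw [logAbsOn_eq, logAbsOn_eq, hconj, slicePoint_conj, h3 _ h1.2.2 _ I.2,
    h3 _ h1.2.2 _ (neg_mem_imUnits I.2), finiteAbs_coe, finiteAbs_coe, symmetrization,
    stemOf_eq h3 h1.2.2,
    ← Real.log_mul (norm_ne_zero_iff.2 (h4 _ I.2))
      (norm_ne_zero_iff.2 (h4 _ (neg_mem_imUnits I.2)))]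
  exact Real.log_le_log (norm_pos_iff.2 h4.normSq_ne_zero) (norm_normSq_le _ I.2)

-- The bound holds for each `I` separately, so it can be averaged over any probability measure. The
-- two terms on the right have equal integrals by the reflection `θ ↦ 2π - θ`, without any symmetry
-- of `μ`.
open MeasureTheory in
theorem circleAverage_le_boundaryLogMean {f : ℍ → OnePoint ℍ} {ρ : ℝ} (hρ : 0 < ρ)
    (h : RegularOnSphere f ρ) (hN : MeromorphicOn (symmetrization f) (Metric.sphere 0 |ρ|))
    (μ : Measure imUnits) [IsProbabilityMeasure μ] :
    Real.circleAverage (Real.log ‖symmetrization f ·‖) 0 ρ ≤ 2 * boundaryLogMean f ρ μ := by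
  set A : ℝ → ℝ := fun θ => ∫ I, logAbsOn f ρ (θ, I) ∂μ with hA
  have hpi : (0 : ℝ) ≤ 2 * Real.pi := by positivity
  have hint := integrable_logAbsOn hρ h μ
  have hAi : IntervalIntegrable A volume 0 (2 * Real.pi) := by
    rw [intervalIntegrable_iff_integrableOn_Ioc_of_le hpi]
    exact hint.integral_prod_left
  have hAi' : IntervalIntegrable (fun θ => A (2 * Real.pi - θ)) volume 0 (2 * Real.pi) := by
    have := (hAi.comp_sub_left (2 * Real.pi)).symm
    simpa using this
  have hci : IntervalIntegrable (fun θ => Real.log ‖symmetrization f (circleMap 0 ρ θ)‖) volume 0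
      (2 * Real.pi) := hN.circleIntegrable_log_norm
  have : CompactSpace imUnits := isCompact_iff_compactSpace.1 isCompact_imUnits
  have hIi : ∀ θ, Integrable (fun I => logAbsOn f ρ (θ, I)) μ := by
    intro θ
    have hc : Continuous fun I : imUnits => logAbsOn f ρ (θ, I) :=
      (continuous_logAbsOn hρ h).comp (by fun_prop)
    exact hc.integrable_of_hasCompactSupport (HasCompactSupport.of_compactSpace _)
  have hle : ∀ θ, Real.log ‖symmetrization f (circleMap 0 ρ θ)‖ ≤ A θ + A (2 * Real.pi - θ) := by
    intro θ
    have h1 := integral_mono (μ := μ) (integrable_const _) ((hIi θ).add (hIi (2 * Real.pi - θ)))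
      (fun I => log_norm_symmetrization_le hρ h θ I)
    simp only [integral_const, probReal_univ, one_smul] at h1
    refine h1.trans_eq ?_
    exact integral_add (hIi θ) (hIi _)
  have h2 := intervalIntegral.integral_mono hpi hci (hAi.add hAi') hle
  have h3 : ∫ θ in (0 : ℝ)..(2 * Real.pi), A (2 * Real.pi - θ)
      = ∫ θ in (0 : ℝ)..(2 * Real.pi), A θ := by
    rw [intervalIntegral.integral_comp_sub_left]
    simp
  have h4 : ∫ θ in (0 : ℝ)..(2 * Real.pi), (A θ + A (2 * Real.pi - θ))
      = 2 * ∫ θ in (0 : ℝ)..(2 * Real.pi), A θ := by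
    rw [intervalIntegral.integral_add hAi hAi', h3]
    ring
  have h5 : boundaryLogMean f ρ μ = 1 / (2 * Real.pi) * ∫ θ in (0 : ℝ)..(2 * Real.pi), A θ := rfl
  rw [Real.circleAverage_def, h5, smul_eq_mul, ← one_div]
  have h6 : (0 : ℝ) ≤ 1 / (2 * Real.pi) := by positivity
  have h7 := mul_le_mul_of_nonneg_left h2 h6
  rw [h4] at h7
  linarith

/-! ### Summation over the exceptional points -/

open Filter Topology in
theorem IsCompact.finite_of_eventually {X : Type*} [TopologicalSpace X] {K : Set X}
    (hK : IsCompact K) {P : X → Prop} (h : ∀ x ∈ K, ∀ᶠ y in 𝓝[≠] x, P y) :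
    {x ∈ K | ¬ P x}.Finite := by
  obtain ⟨t, ht⟩ := hK.elim_nhds_subcover' (fun x _ => {y | y ≠ x → P y})
    (fun x hx => eventually_nhdsWithin_iff.1 (h x hx))
  refine (t.finite_toSet.image Subtype.val).subset ?_
  rintro x ⟨hx, hPx⟩
  have hx' := ht hx
  obtain ⟨y, hy, hxy⟩ := Set.mem_iUnion₂.1 hx'
  refine ⟨y, hy, ?_⟩
  by_contra hne
  exact hPx (hxy fun h => hne h.symm)

/-- The sums in the theorem run over quaternions, real numbers and half discs. This moves each to
one common finite set `E` of complex points, matching along `φ` the indices whose multiplicity is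
nonzero. -/
theorem finite_and_finsum_mem_eq_sum {α : Type*} {s : Set α} {φ : α → ℂ} {c : α → ℤ} {C : ℂ → ℤ}
    {E : Finset ℂ} {L : ℂ → ℝ}
    (hmem : ∀ a ∈ s, c a ≠ 0 → φ a ∈ E ∧ C (φ a) = c a)
    (hinj : Set.InjOn φ {a | a ∈ s ∧ c a ≠ 0})
    (hsurj : ∀ z ∈ E, C z ≠ 0 → ∃ a ∈ s, c a ≠ 0 ∧ φ a = z) :
    {a | a ∈ s ∧ c a ≠ 0}.Finite ∧
      ∑ᶠ a ∈ s, (c a : ℝ) * L (φ a) = ∑ z ∈ E, (C z : ℝ) * L z := by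
  have hmaps : Set.MapsTo φ {a | a ∈ s ∧ c a ≠ 0} (E : Set ℂ) := fun a ha => (hmem a ha.1 ha.2).1
  refine ⟨Set.Finite.of_injOn hmaps hinj E.finite_toSet, ?_⟩
  have hbij : Set.BijOn φ {a | a ∈ s ∧ c a ≠ 0} {z | z ∈ (E : Set ℂ) ∧ C z ≠ 0} := by
    refine ⟨fun a ha => ?_, hinj, ?_⟩
    · obtain ⟨h1, h2⟩ := hmem a ha.1 ha.2
      exact ⟨h1, h2 ▸ ha.2⟩
    · rintro z ⟨hz, hCz⟩
      obtain ⟨a, ha, hca, rfl⟩ := hsurj z hz hCz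
      exact ⟨a, ⟨ha, hca⟩, rfl⟩
  have h1 := finsum_mem_eq_of_bijOn (f := fun a => (c a : ℝ) * L (φ a))
    (g := fun z => (C z : ℝ) * L z) φ hbij (fun a ha => by rw [(hmem a ha.1 ha.2).2])
  rw [← finsum_mem_coe_finset]
  rw [finsum_mem_inter_support_eq (fun a => (c a : ℝ) * L (φ a)) s {a | a ∈ s ∧ c a ≠ 0}, h1,
    finsum_mem_inter_support_eq (fun z => (C z : ℝ) * L z) (E : Set ℂ)
      {z | z ∈ (E : Set ℂ) ∧ C z ≠ 0}]
  · ext z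
    constructor
    · rintro ⟨h2, h3⟩
      refine ⟨⟨h2, fun h => h3 ?_⟩, h3⟩
      simp [h]
    · rintro ⟨h2, h3⟩
      exact ⟨h2.1, h3⟩
  · ext z
    constructor
    · rintro ⟨h2, h3⟩
      refine ⟨⟨h2, fun h => h3 ?_⟩, h3⟩
      simp [h]
    · rintro ⟨h2, h3⟩
      exact ⟨h2.1, h3⟩

/-- A sum over conjugation-invariant points reduces to the closed upper half plane. -/
theorem sum_union_image_conj {E : Finset ℂ} (hE : ∀ z ∈ E, 0 ≤ z.im) {g : ℂ → ℝ}
    (hg : ∀ z, g (conj z) = g z) :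
    ∑ z ∈ E ∪ E.image (starRingEnd ℂ), g z = ∑ z ∈ E, if z.im = 0 then g z else 2 * g z := by
  have h1 := Finset.sum_union_inter (s₁ := E) (s₂ := E.image (starRingEnd ℂ)) (f := g)
  have h2 : ∑ z ∈ E.image (starRingEnd ℂ), g z = ∑ z ∈ E, g z := by
    rw [Finset.sum_image (fun x _ y _ h => (starRingEnd ℂ).injective h)]
    exact Finset.sum_congr rfl fun z _ => hg z
  -- Real points are the only overlap of the two halves, so they alone are counted once.
  have h3 : E ∩ E.image (starRingEnd ℂ) = E.filter (fun z => z.im = 0) := by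
    ext z
    simp only [Finset.mem_inter, Finset.mem_image, Finset.mem_filter]
    constructor
    · rintro ⟨hz, y, hy, rfl⟩
      refine ⟨hz, ?_⟩
      have a1 := hE _ hz
      have a2 := hE _ hy
      rw [Complex.conj_im] at a1 ⊢
      linarith
    · rintro ⟨hz, h0⟩
      exact ⟨hz, z, hz, Complex.conj_eq_iff_im.2 h0⟩
  rw [h2, h3, Finset.sum_filter] at h1
  have h4 : ∑ z ∈ E, (if z.im = 0 then g z else 2 * g z)
      = ∑ z ∈ E, (g z + g z) - ∑ z ∈ E, if z.im = 0 then g z else 0 := by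
    rw [← Finset.sum_sub_distrib]
    refine Finset.sum_congr rfl fun z _ => ?_
    split_ifs <;> ring
  rw [h4, Finset.sum_add_distrib]
  linarith

/-! ### Comparison of the multiplicities with the divisor. -/

theorem meromorphicOrderAt_symmetrization_conj {f : ℍ → OnePoint ℍ} {z : ℂ} {k : ℤ}
    (h : HasSliceDivisorAt f z k) :
    meromorphicOrderAt (symmetrization f) (conj z) = meromorphicOrderAt (symmetrization f) z := by
  obtain ⟨U, G, H, m, n, hq, hm, hn, rfl⟩ := h
  have hq' : IsLocalQuotient f (conj z) U G H := by
    refine ⟨IsSymmNhd.conj (by simpa using hq.nhd), hq.hol_den, hq.hol_num, ?_, ?_⟩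
    · intro w hw
      refine hq.den_ne_zero w ⟨hw.1, fun h => hw.2 ?_⟩
      rw [Complex.conj_conj, Set.pair_comm]
      exact h
    · have := hq.induced
      rwa [Complex.conj_conj, Set.pair_comm]
  have key : ∀ {F : ℂ → ℍ[ℂ]} {j : ℕ}, HasMultiplicity F z j → HasMultiplicity F (conj z) j := by
    rintro F j ⟨V, l, K, h1, h2, h3, h4, h5, h6⟩
    refine ⟨V, l, K, IsSymmNhd.conj (by simpa using h1), h2, by simpa [sphereOf_conj] using h3, h4,
      fun I hI => ?_, h6⟩
    rw [h4.stem z h1.2.2, evalAt_complexConj]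
    exact h5 _ (neg_mem_imUnits hI)
  have h1 : HasSliceDivisorAt f (conj z) ((m : ℤ) - n) := ⟨U, G, H, m, n, hq', key hm, key hn, rfl⟩
  have h2 : HasSliceDivisorAt f z ((m : ℤ) - n) := ⟨U, G, H, m, n, hq, hm, hn, rfl⟩
  rw [h1.meromorphicOrderAt_eq, h2.meromorphicOrderAt_eq]
  simp [sphereWeight]

/-- The number of punctual zeros on the sphere `𝕊_z`, expressed through the other
multiplicities. -/
def punctualMultOn (f : ℍ → OnePoint ℍ) (z : ℂ) : ℤ :=
  if z.im = 0 then punctualZeroMult f (z.re : ℍ)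
  else sliceDivisor f z - 2 * sphericalZeroMult f z + 2 * sphericalPoleMult f z

theorem IsSemiRegular.exists_hasSliceDivisorAt {D : Set ℂ} {f : ℍ → OnePoint ℍ} (hf : IsSemiRegular D f) {z : ℂ}
    (hz : z ∈ D) (hN : meromorphicOrderAt (symmetrization f) z ≠ ⊤) :
    ∃ k, HasSliceDivisorAt f z k := by
  obtain ⟨U, -, G, H, h⟩ := hf.local_quotient z hz
  exact h.exists_hasSliceDivisorAt hN

theorem HasLocalForm.sliceDivisor_eq {f : ℍ → OnePoint ℍ} {z : ℂ} {s k : ℤ} {l : List ℍ}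
    (h : HasLocalForm f z s l) (hk : HasSliceDivisorAt f z k) :
    sliceDivisor f z = 2 * s + l.length := by
  rw [hk.sliceDivisor_eq]
  have h1 := hk.meromorphicOrderAt_eq
  rw [h.meromorphicOrderAt_eq] at h1
  exact (mul_left_cancel₀ (sphereWeight_pos z).ne' (by exact_mod_cast h1)).symm

theorem HasSphericalForm.punctualMultOn_eq {f : ℍ → OnePoint ℍ} {z : ℂ} (hz : 0 < z.im) {m k : ℤ}
    {l : List ℍ} (h : HasSphericalForm f z m l) (hk : HasSliceDivisorAt f z k) :
    punctualMultOn f z = l.length := by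
  rw [punctualMultOn, if_neg hz.ne', h.sphericalZeroMult_eq hz, h.sphericalPoleMult_eq hz,
    h.hasLocalForm.sliceDivisor_eq hk]
  omega

theorem HasLocalForm.hasSphericalForm_nil {f : ℍ → OnePoint ℍ} {z : ℂ}
    (h : HasLocalForm f z 0 []) : HasSphericalForm f z 0 [] := by
  obtain ⟨U, K, h1, h2, h3, h4, h6⟩ := h
  exact ⟨U, K, h1, h2, h3, h4, by simp, h6⟩

theorem punctualMultOn_upperPoint {f : ℍ → OnePoint ℍ} {p : ℍ} {s k : ℤ} {l : List ℍ}
    (h : HasLocalForm f (upperPoint p) s l) (hk : HasSliceDivisorAt f (upperPoint p) k)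
    (hp : punctualZeroMult f p ≠ 0) : punctualMultOn f (upperPoint p) = punctualZeroMult f p := by
  rcases (upperPoint_im_nonneg p).eq_or_lt' with h0 | h0
  · obtain ⟨x, hx⟩ := Complex.conj_eq_iff_real.1 (Complex.conj_eq_iff_im.2 h0)
    rw [punctualMultOn, if_pos h0, hx, Complex.ofReal_re, ← eq_ofReal_of_upperPoint_eq hx]
  · obtain ⟨m, l', h'⟩ := h.exists_hasSphericalForm
    rw [h'.punctualMultOn_eq h0 hk]
    rw [h'.punctualZeroMult_eq h0 rfl] at hp ⊢
    split_ifs at hp ⊢ with hl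
    · rfl
    · exact absurd rfl hp

/-- A non-real sphere carries at most one punctual zero, the head of its reduced list. -/
theorem upperPoint_injOn_punctual {f : ℍ → OnePoint ℍ} {p p' : ℍ} {s : ℤ} {l : List ℍ}
    (h : HasLocalForm f (upperPoint p) s l) (hp : punctualZeroMult f p ≠ 0)
    (hp' : punctualZeroMult f p' ≠ 0) (he : upperPoint p = upperPoint p') : p = p' := by
  rcases (upperPoint_im_nonneg p).eq_or_lt' with h0 | h0
  · obtain ⟨x, hx⟩ := Complex.conj_eq_iff_real.1 (Complex.conj_eq_iff_im.2 h0)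
    rw [eq_ofReal_of_upperPoint_eq hx, eq_ofReal_of_upperPoint_eq (he.symm.trans hx)]
  · obtain ⟨m, l', h'⟩ := h.exists_hasSphericalForm
    rw [h'.punctualZeroMult_eq h0 rfl] at hp
    rw [h'.punctualZeroMult_eq h0 he.symm] at hp'
    split_ifs at hp hp' with h1 h2
    · rw [h1] at h2
      exact Option.some_inj.1 h2
    all_goals simp_all

theorem exists_punctual_of_punctualMultOn {f : ℍ → OnePoint ℍ} {z : ℂ} (hz : 0 ≤ z.im) {s k : ℤ}
    {l : List ℍ} (h : HasLocalForm f z s l) (hk : HasSliceDivisorAt f z k)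
    (h0 : punctualMultOn f z ≠ 0) : ∃ p, punctualZeroMult f p ≠ 0 ∧ upperPoint p = z := by
  rcases hz.eq_or_lt' with hi | hi
  · obtain ⟨x, rfl⟩ := Complex.conj_eq_iff_real.1 (Complex.conj_eq_iff_im.2 hi)
    refine ⟨x, ?_, upperPoint_ofReal x⟩
    simpa [punctualMultOn] using h0
  · obtain ⟨m, l', h'⟩ := h.exists_hasSphericalForm
    rw [h'.punctualMultOn_eq hi hk] at h0
    have hmem := h'
    obtain ⟨-, -, -, -, -, hmem, -⟩ := hmem
    cases l' with
    | nil => simp at h0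
    | cons p l'' =>
      have hp := upperPoint_eq_of_mem_sphereOf hz (hmem p (by simp))
      refine ⟨p, ?_, hp⟩
      rw [h'.punctualZeroMult_eq hi hp]
      simp

/-! ### The ingredients of Jensen's formula for the symmetrization. -/

open Filter Topology in
-- Since `f` is finite at `0`, it is slice regular there, and its stem value at the real point `0`
-- is the quaternion `f 0`. The symmetrization then equals `|f 0|² ≠ 0`.
theorem IsSemiRegular.trailingCoeff_zero {D : Set ℂ} {f : ℍ → OnePoint ℍ}
    (hf : IsSemiRegular D f) (hD : IsSymmetricSet D) (h0 : (0 : ℂ) ∈ D)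
    (hf0 : f 0 ≠ ((0 : ℍ) : OnePoint ℍ)) (hf0' : f 0 ≠ OnePoint.infty) :
    meromorphicOrderAt (symmetrization f) 0 = 0 ∧
      Real.log ‖meromorphicTrailingCoeffAt (symmetrization f) 0‖
        = 2 * Real.log (finiteAbs (f 0)) := by
  have hN := hf.order_zero_ne_top h0 hf0
  obtain ⟨U, F, h1, h2, h3⟩ := hf.exists_inducedOn_of_order hD h0 hN (by simpa using hN) (by
    rintro q ⟨I, hI, rfl⟩
    simpa [slicePoint] using hf0')
  have him : stemIm (F 0) = 0 := stemIm_eq_zero_of_conj_eq h2 h1.2.2 (by simp)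
  have hval : f 0 = ((stemRe (F 0) : ℍ) : OnePoint ℍ) := by
    have := h3 0 h1.2.2 stdUnit stdUnit_mem
    simpa [slicePoint, evalAt, him] using this
  have hne : stemRe (F 0) ≠ 0 := fun h => hf0 (by rw [hval, h])
  have hn : Quaternion.normSq (F 0) = ((‖stemRe (F 0)‖ ^ 2 : ℝ) : ℂ) :=
    normSq_of_stemIm_eq_zero him
  have hn0 : Quaternion.normSq (F 0) ≠ 0 := by
    rw [hn, Complex.ofReal_ne_zero]
    exact pow_ne_zero _ (norm_ne_zero_iff.2 hne)
  have han := h2.analyticAt_normSq h1.1 h1.2.2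
  have hev : symmetrization f =ᶠ[𝓝[≠] 0] fun w => Quaternion.normSq (F w) := by
    filter_upwards [nhdsWithin_le_nhds (h1.1.mem_nhds h1.2.2)] with w hw
    rw [symmetrization, stemOf_eq h3 hw]
  constructor
  · rw [meromorphicOrderAt_congr hev, han.meromorphicOrderAt_eq, han.analyticOrderAt_eq_zero.2 hn0]
    rfl
  · rw [meromorphicTrailingCoeffAt_congr_nhdsNE hev,
      han.meromorphicTrailingCoeffAt_of_ne_zero hn0, hn, hval, finiteAbs_coe, Complex.norm_real,
      Real.norm_of_nonneg (by positivity), Real.log_pow]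
    norm_num

theorem IsSemiRegular.regularOnSphere {D : Set ℂ} {f : ℍ → OnePoint ℍ}
    (hf : IsSemiRegular D f) (hD : IsSymmetricSet D) {ρ : ℝ} (hρ : 0 < ρ)
    (hball : Metric.closedBall (0 : ℂ) ρ ⊆ D) (hf0 : f 0 ≠ ((0 : ℍ) : OnePoint ℍ))
    (hbd : ∀ y ∈ Metric.sphere (0 : ℍ) ρ,
      f y ≠ ((0 : ℍ) : OnePoint ℍ) ∧ f y ≠ OnePoint.infty) : RegularOnSphere f ρ := by
  intro z hz
  have hzb : z ∈ Metric.closedBall (0 : ℂ) ρ := mem_closedBall_zero_iff.2 hz.le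
  have hzb' : conj z ∈ Metric.closedBall (0 : ℂ) ρ := by
    rw [mem_closedBall_zero_iff, RCLike.norm_conj]
    exact hz.le
  have hsph : ∀ I ∈ imUnits, slicePoint z I ∈ Metric.sphere (0 : ℍ) ρ := fun I hI => by
    rw [mem_sphere_zero_iff_norm, norm_slicePoint hI, hz]
  obtain ⟨U, F, h1, h2, h3⟩ := hf.exists_inducedOn_of_order hD (hball hzb)
    (hf.order_ne_top hρ hball hf0 hzb) (hf.order_ne_top hρ hball hf0 hzb') (by
      rintro q ⟨I, hI, rfl⟩
      exact (hbd _ (hsph I hI)).2)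
  refine ⟨U, F, h1, h2, h3, fun I hI h0 => (hbd _ (hsph I hI)).1 ?_⟩
  rw [h3 z h1.2.2 I hI, h0]

/-- The sum over zeros and poles in Jensen's formula for the symmetrization. -/
theorem IsSemiRegular.finsum_divisor {D : Set ℂ} {f : ℍ → OnePoint ℍ} (hf : IsSemiRegular D f)
    {ρ : ℝ} (hρ : 0 < ρ) (hball : Metric.closedBall (0 : ℂ) ρ ⊆ D)
    (hf0 : f 0 ≠ ((0 : ℍ) : OnePoint ℍ)) {E : Finset ℂ}
    (hE : ∀ z, z ∈ E ↔ z ∈ closedUpperHalfDisc ρ ∧ ¬ HasLocalForm f z 0 []) :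
    ∑ᶠ u, (MeromorphicOn.divisor (symmetrization f) (Metric.closedBall 0 ρ) u : ℝ)
        * Real.log (ρ * ‖0 - u‖⁻¹)
      = 2 * ∑ z ∈ E, (sliceDivisor f z : ℝ) * Real.log (ρ / ‖z‖) := by
  have hmer : MeromorphicOn (symmetrization f) (Metric.closedBall 0 ρ) :=
    fun w hw => hf.meromorphicAt (hball hw)
  set d := MeromorphicOn.divisor (symmetrization f) (Metric.closedBall 0 ρ) with hd
  have hconj : ∀ {z : ℂ}, conj z ∈ Metric.closedBall (0 : ℂ) ρ ↔
      z ∈ Metric.closedBall (0 : ℂ) ρ := fun {z} => by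
    rw [mem_closedBall_zero_iff, mem_closedBall_zero_iff, RCLike.norm_conj]
  have hdiv : ∀ z ∈ Metric.closedBall (0 : ℂ) ρ, ∃ k, HasSliceDivisorAt f z k := fun z hz =>
    hf.exists_hasSliceDivisorAt (hball hz) (hf.order_ne_top hρ hball hf0 hz)
  have hout : ∀ z, z ∉ Metric.closedBall (0 : ℂ) ρ → d z = 0 := fun z hz =>
    Function.locallyFinsuppWithin.apply_eq_zero_of_notMem d hz
  have hdc : ∀ z, d (conj z) = d z := by
    intro z
    by_cases hz : z ∈ Metric.closedBall (0 : ℂ) ρ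
    · obtain ⟨k, hk⟩ := hdiv z hz
      rw [hd, MeromorphicOn.divisor_apply hmer hz, MeromorphicOn.divisor_apply hmer (hconj.2 hz),
        meromorphicOrderAt_symmetrization_conj hk]
    · rw [hout z hz, hout _ (fun h => hz (hconj.1 h))]
  have hdE : ∀ z ∈ Metric.closedBall (0 : ℂ) ρ, d z = sphereWeight z * sliceDivisor f z := by
    intro z hz
    obtain ⟨k, hk⟩ := hdiv z hz
    rw [hd, MeromorphicOn.divisor_apply hmer hz, hk.meromorphicOrderAt_eq, hk.sliceDivisor_eq,
      WithTop.untop₀_coe]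
  have hmemE : ∀ z, 0 ≤ z.im → d z ≠ 0 → ‖z‖ ≠ ρ → z ∈ E := by
    intro z hz hdz hzρ
    have hzb : z ∈ Metric.closedBall (0 : ℂ) ρ := by
      by_contra h
      exact hdz (hout z h)
    refine (hE z).2 ⟨⟨hz, lt_of_le_of_ne (mem_closedBall_zero_iff.1 hzb) hzρ⟩, fun ht => hdz ?_⟩
    rw [hd, MeromorphicOn.divisor_apply hmer hzb, ht.meromorphicOrderAt_eq, WithTop.untop₀_coe]
    simp
  have hsupp : Function.support (fun u => (d u : ℝ) * Real.log (ρ * ‖0 - u‖⁻¹))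
      ⊆ ((E ∪ E.image (starRingEnd ℂ) : Finset ℂ) : Set ℂ) := by
    intro u hu
    obtain ⟨hu1, hu2⟩ := mul_ne_zero_iff.1 (Function.mem_support.1 hu)
    have hdu : d u ≠ 0 := by exact_mod_cast hu1
    -- Jensen's formula uses the divisor on the closed disc, but points on the circle carry the
    -- factor `log 1 = 0`.
    have huρ : ‖u‖ ≠ ρ := by
      rintro rfl
      rw [zero_sub, norm_neg, mul_inv_cancel₀ hρ.ne', Real.log_one] at hu2
      exact hu2 rfl
    rw [Finset.mem_coe, Finset.mem_union, Finset.mem_image]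
    rcases le_total 0 u.im with hi | hi
    · exact Or.inl (hmemE u hi hdu huρ)
    · refine Or.inr ⟨conj u, hmemE _ (by simpa using hi) (by rwa [hdc]) (by rwa [RCLike.norm_conj]),
        Complex.conj_conj u⟩
  rw [finsum_eq_sum_of_support_subset _ hsupp, sum_union_image_conj (fun z hz => ((hE z).1 hz).1.1),
    Finset.mul_sum]
  -- The factor two has two sources: a real point counts once with weight two, a non-real one has
  -- weight one and counts together with its conjugate.
  · refine Finset.sum_congr rfl fun z hz => ?_
    have hzc := ((hE z).1 hz).1
    rw [hdE z (mem_closedBall_zero_iff.2 hzc.2.le), zero_sub, norm_neg, ← div_eq_mul_inv,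
      sphereWeight]
    split_ifs <;> push_cast <;> ring
  · intro z
    rw [hdc, zero_sub, zero_sub, norm_neg, norm_neg, RCLike.norm_conj]

/-- At every point the coefficient of the divisor is the balance of the multiplicities. -/
theorem HasLocalForm.sliceDivisor_balance {f : ℍ → OnePoint ℍ} {z : ℂ} (hz : 0 ≤ z.im) {s k : ℤ}
    {l : List ℍ} (h : HasLocalForm f z s l) (hk : HasSliceDivisorAt f z k) :
    sliceDivisor f z = punctualMultOn f z - (if z.im = 0 then (realPoleMult f z.re : ℤ) else 0)
      + 2 * (if 0 < z.im then (sphericalZeroMult f z : ℤ) else 0)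
      - 2 * (if 0 < z.im then (sphericalPoleMult f z : ℤ) else 0) := by
  rcases hz.eq_or_lt' with hi | hi
  · obtain ⟨x, rfl⟩ := Complex.conj_eq_iff_real.1 (Complex.conj_eq_iff_im.2 hi)
    have hr := h.hasRealOrder
    rw [punctualMultOn, if_pos hi, if_pos hi, if_neg hi.not_gt, if_neg hi.not_gt,
      h.sliceDivisor_eq hk, Complex.ofReal_re, hr.punctualZeroMult_eq, hr.realPoleMult_eq]
    omega
  · rw [punctualMultOn, if_neg hi.ne', if_neg hi.ne', if_pos hi, if_pos hi]
    omega

end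

theorem proposition9
    (D : Set ℂ) (hD_open : IsOpen D) (hD_conn : IsConnected D) (hD_symm : IsSymmetricSet D)
    (f : ℍ → OnePoint ℍ) (hf : IsSemiRegular D f)
    (ρ : ℝ) (hρ : 0 < ρ) (hball : Metric.closedBall (0 : ℍ) ρ ⊆ circularization D)
    (hf0 : f 0 ≠ ((0 : ℍ) : OnePoint ℍ)) (hf0' : f 0 ≠ OnePoint.infty)
    (hbd : ∀ y ∈ Metric.sphere (0 : ℍ) ρ,
      f y ≠ ((0 : ℍ) : OnePoint ℍ) ∧ f y ≠ OnePoint.infty)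
    (μ : MeasureTheory.Measure imUnits) [MeasureTheory.IsProbabilityMeasure μ] :
    -- the boundary integral converges absolutely
    MeasureTheory.Integrable
      (fun t : ℝ × imUnits => Real.log (finiteAbs
        (f (((ρ * Real.cos t.1 : ℝ) : ℍ) + (ρ * Real.sin t.1) • (t.2 : ℍ)))))
      ((MeasureTheory.volume.restrict (Set.Ioc (0 : ℝ) (2 * Real.pi))).prod μ) ∧
    -- Jensen's formula, zeros and poles being counted separately
    ({p : ℍ | ‖p‖ < ρ ∧ punctualZeroMult f p ≠ 0}.Finite ∧
      {x : ℝ | |x| < ρ ∧ realPoleMult f x ≠ 0}.Finite ∧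
      {z ∈ openUpperHalfDisc ρ | sphericalZeroMult f z ≠ 0}.Finite ∧
      {z ∈ openUpperHalfDisc ρ | sphericalPoleMult f z ≠ 0}.Finite ∧
      Real.log (finiteAbs (f 0)) ≤ boundaryLogMean f ρ μ
        - ∑ᶠ p ∈ {p : ℍ | ‖p‖ < ρ}, (punctualZeroMult f p : ℝ) * Real.log (ρ / ‖p‖)
        + ∑ᶠ x ∈ {x : ℝ | |x| < ρ}, (realPoleMult f x : ℝ) * Real.log (ρ / |x|)
        - 2 * ∑ᶠ z ∈ openUpperHalfDisc ρ, (sphericalZeroMult f z : ℝ) * Real.log (ρ / ‖z‖)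
        + 2 * ∑ᶠ z ∈ openUpperHalfDisc ρ, (sphericalPoleMult f z : ℝ) * Real.log (ρ / ‖z‖)) ∧
    -- Jensen's formula in terms of the slice divisor
    ({z ∈ closedUpperHalfDisc ρ | sliceDivisor f z ≠ 0}.Finite ∧
      Real.log (finiteAbs (f 0)) ≤ boundaryLogMean f ρ μ
        - ∑ᶠ z ∈ closedUpperHalfDisc ρ, (sliceDivisor f z : ℝ) * Real.log (ρ / ‖z‖)) := by
  have hcb := closedBall_subset_of_circularization hD_symm hball
  have h0D : (0 : ℂ) ∈ D := hcb (Metric.mem_closedBall_self hρ.le)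
  have hreg := hf.regularOnSphere hD_symm hρ hcb hf0 hbd
  have hord := fun z hz => hf.order_ne_top hρ hcb hf0 (z := z) hz
  have hmer : MeromorphicOn (symmetrization f) (Metric.closedBall 0 ρ) :=
    fun w hw => hf.meromorphicAt (hcb hw)
  have hCU : ∀ z ∈ closedUpperHalfDisc ρ, z ∈ Metric.closedBall (0 : ℂ) ρ := fun z hz =>
    mem_closedBall_zero_iff.2 hz.2.le
  have hloc : ∀ z ∈ closedUpperHalfDisc ρ, ∃ s l, HasLocalForm f z s l := fun z hz =>
    hf.exists_hasLocalForm (hcb (hCU z hz)) (hord z (hCU z hz))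
  have hdiv : ∀ z ∈ closedUpperHalfDisc ρ, ∃ k, HasSliceDivisorAt f z k := fun z hz =>
    hf.exists_hasSliceDivisorAt (hcb (hCU z hz)) (hord z (hCU z hz))
  -- Where the local form is trivial, all multiplicities vanish. The exceptional points are isolated
  -- at every point of the compact disc, boundary included, hence finite in number.
  have hfin : {z | z ∈ closedUpperHalfDisc ρ ∧ ¬ HasLocalForm f z 0 []}.Finite := by
    refine ((isCompact_closedBall (0 : ℂ) ρ).finite_of_eventually
      (P := fun z => HasLocalForm f z 0 []) fun z hz => ?_).subset fun z hz => ⟨hCU z hz.1, hz.2⟩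
    obtain ⟨s, l, h⟩ := hf.exists_hasLocalForm (hcb hz) (hord z hz)
    exact h.eventually_trivial
  set E : Finset ℂ := hfin.toFinset with hEdef
  have hE : ∀ z, z ∈ E ↔ z ∈ closedUpperHalfDisc ρ ∧ ¬ HasLocalForm f z 0 [] := fun z => by
    rw [hEdef, Set.Finite.mem_toFinset, Set.mem_ofPred_eq]
  have hup : ∀ p : ℍ, ‖p‖ < ρ → upperPoint p ∈ closedUpperHalfDisc ρ := fun p hp =>
    ⟨upperPoint_im_nonneg p, by rwa [norm_upperPoint]⟩
  have hOU : ∀ z ∈ openUpperHalfDisc ρ, z ∈ closedUpperHalfDisc ρ := fun z hz => ⟨hz.1.le, hz.2⟩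
  set L : ℂ → ℝ := fun z => Real.log (ρ / ‖z‖) with hL
  obtain ⟨hfd, hsd⟩ := finite_and_finsum_mem_eq_sum (s := closedUpperHalfDisc ρ) (φ := id)
    (c := sliceDivisor f) (C := sliceDivisor f) (E := E) (L := L)
    (fun z hz h0 => by
      refine ⟨(hE z).2 ⟨hz, fun ht => h0 ?_⟩, rfl⟩
      obtain ⟨k, hk⟩ := hdiv z hz
      simpa using ht.sliceDivisor_eq hk)
    Function.injective_id.injOn (fun z hz h0 => ⟨z, ((hE z).1 hz).1, h0, rfl⟩)
  -- A punctual zero is indexed by its sphere; `upperPoint` is injective on such zeros and preserves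
  -- the norm.
  obtain ⟨hfp, hsp⟩ := finite_and_finsum_mem_eq_sum (s := {p : ℍ | ‖p‖ < ρ}) (φ := upperPoint)
    (c := fun p => (punctualZeroMult f p : ℤ)) (C := punctualMultOn f) (E := E) (L := L)
    (fun p hp h0 => by
      have h0' : punctualZeroMult f p ≠ 0 := by exact_mod_cast h0
      obtain ⟨s, l, h⟩ := hloc _ (hup p hp)
      obtain ⟨k, hk⟩ := hdiv _ (hup p hp)
      have h1 := punctualMultOn_upperPoint h hk h0'
      refine ⟨(hE _).2 ⟨hup p hp, fun ht => ?_⟩, h1⟩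
      rcases (upperPoint_im_nonneg p).eq_or_lt' with hi | hi
      · obtain ⟨x, hx⟩ := Complex.conj_eq_iff_real.1 (Complex.conj_eq_iff_im.2 hi)
        rw [hx] at ht
        rw [eq_ofReal_of_upperPoint_eq hx, ht.hasRealOrder.punctualZeroMult_eq] at h0'
        simp at h0'
      · rw [ht.hasSphericalForm_nil.punctualMultOn_eq hi hk] at h1
        apply h0
        simpa using h1.symm)
    (fun p hp p' hp' he => by
      obtain ⟨s, l, h⟩ := hloc _ (hup p hp.1)
      exact upperPoint_injOn_punctual h (by exact_mod_cast hp.2) (by exact_mod_cast hp'.2) he)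
    (fun z hz h0 => by
      have hzc := ((hE z).1 hz).1
      obtain ⟨s, l, h⟩ := hloc _ hzc
      obtain ⟨k, hk⟩ := hdiv _ hzc
      obtain ⟨p, hp, rfl⟩ := exists_punctual_of_punctualMultOn hzc.1 h hk h0
      refine ⟨p, ?_, by exact_mod_cast hp, rfl⟩
      have := hzc.2
      rwa [norm_upperPoint] at this)
  obtain ⟨hfr, hsr⟩ := finite_and_finsum_mem_eq_sum (s := {x : ℝ | |x| < ρ})
    (φ := fun x : ℝ => (x : ℂ)) (c := fun x => (realPoleMult f x : ℤ))
    (C := fun z => if z.im = 0 then (realPoleMult f z.re : ℤ) else 0) (E := E) (L := L)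
    (fun x hx h0 => by
      refine ⟨(hE _).2 ⟨⟨by simp, by rwa [Complex.norm_real]⟩, fun ht => h0 ?_⟩, by simp⟩
      rw [ht.hasRealOrder.realPoleMult_eq]
      simp)
    Complex.ofReal_injective.injOn
    (fun z hz h0 => by
      have hzc := ((hE z).1 hz).1
      split_ifs at h0 with hi
      · obtain ⟨x, rfl⟩ := Complex.conj_eq_iff_real.1 (Complex.conj_eq_iff_im.2 hi)
        refine ⟨x, ?_, h0, rfl⟩
        have := hzc.2
        rwa [Complex.norm_real] at this
      · exact absurd rfl h0)
  obtain ⟨hfz, hsz⟩ := finite_and_finsum_mem_eq_sum (s := openUpperHalfDisc ρ) (φ := id)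
    (c := fun z => (sphericalZeroMult f z : ℤ))
    (C := fun z => if 0 < z.im then (sphericalZeroMult f z : ℤ) else 0) (E := E) (L := L)
    (fun z hz h0 => by
      refine ⟨(hE z).2 ⟨hOU z hz, fun ht => h0 ?_⟩, if_pos hz.1⟩
      rw [ht.hasSphericalForm_nil.sphericalZeroMult_eq hz.1]
      simp)
    Function.injective_id.injOn
    (fun z hz h0 => by
      have hzc := ((hE z).1 hz).1
      split_ifs at h0 with hi
      · exact ⟨z, ⟨hi, hzc.2⟩, h0, rfl⟩
      · exact absurd rfl h0)
  obtain ⟨hfb, hsb⟩ := finite_and_finsum_mem_eq_sum (s := openUpperHalfDisc ρ) (φ := id)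
    (c := fun z => (sphericalPoleMult f z : ℤ))
    (C := fun z => if 0 < z.im then (sphericalPoleMult f z : ℤ) else 0) (E := E) (L := L)
    (fun z hz h0 => by
      refine ⟨(hE z).2 ⟨hOU z hz, fun ht => h0 ?_⟩, if_pos hz.1⟩
      rw [ht.hasSphericalForm_nil.sphericalPoleMult_eq hz.1]
      simp)
    Function.injective_id.injOn
    (fun z hz h0 => by
      have hzc := ((hE z).1 hz).1
      split_ifs at h0 with hi
      · exact ⟨z, ⟨hi, hzc.2⟩, h0, rfl⟩
      · exact absurd rfl h0)
  simp only [id_eq, hL, norm_upperPoint, Complex.norm_real, Real.norm_eq_abs, Int.cast_natCast]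
    at hsd hsp hsr hsz hsb
  simp only [ne_eq, Nat.cast_eq_zero] at hfd hfp hfr hfz hfb
  have hjensen : Real.log (finiteAbs (f 0)) ≤ boundaryLogMean f ρ μ
      - ∑ z ∈ E, (sliceDivisor f z : ℝ) * Real.log (ρ / ‖z‖) := by
    -- Jensen's formula for the symmetrization. Its extra term at the centre disappears because the
    -- order there is `0`, and every other term but the average carries a factor two.
    have h1 := MeromorphicOn.circleAverage_log_norm (c := 0) (f := symmetrization f) hρ.ne'
      (by rwa [abs_of_pos hρ])
    obtain ⟨h2, h3⟩ := hf.trailingCoeff_zero hD_symm h0D hf0 hf0'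
    rw [abs_of_pos hρ, hf.finsum_divisor hρ hcb hf0 hE, h3,
      MeromorphicOn.divisor_apply hmer (Metric.mem_closedBall_self hρ.le), h2] at h1
    have h4 := circleAverage_le_boundaryLogMean hρ hreg
      (fun w hw => hmer w (Metric.sphere_subset_closedBall (by rwa [abs_of_pos hρ] at hw))) μ
    rw [h1] at h4
    simp only [WithTop.untop₀_zero, Int.cast_zero, zero_mul, add_zero] at h4
    linarith
  refine ⟨integrable_logAbsOn hρ hreg μ, ⟨hfp, hfr, hfz, hfb, ?_⟩, hfd, by rwa [hsd]⟩
  rw [hsp, hsr, hsz, hsb]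
  refine hjensen.trans_eq ?_
  -- The first formula is the second with each divisor coefficient split into its zeros and poles.
  have hbal : ∑ z ∈ E, (sliceDivisor f z : ℝ) * Real.log (ρ / ‖z‖)
      = ∑ z ∈ E, ((punctualMultOn f z : ℝ) * Real.log (ρ / ‖z‖)
        - ((if z.im = 0 then (realPoleMult f z.re : ℤ) else 0 : ℤ) : ℝ) * Real.log (ρ / ‖z‖)
        + 2 * (((if 0 < z.im then (sphericalZeroMult f z : ℤ) else 0 : ℤ) : ℝ)
          * Real.log (ρ / ‖z‖))
        - 2 * (((if 0 < z.im then (sphericalPoleMult f z : ℤ) else 0 : ℤ) : ℝ)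
          * Real.log (ρ / ‖z‖))) := by
    refine Finset.sum_congr rfl fun z hz => ?_
    have hzc := ((hE z).1 hz).1
    obtain ⟨s, l, h⟩ := hloc _ hzc
    obtain ⟨k, hk⟩ := hdiv _ hzc
    rw [h.sliceDivisor_balance hzc.1 hk]
    push_cast
    ring
  rw [hbal, Finset.sum_sub_distrib, Finset.sum_add_distrib, Finset.sum_sub_distrib,
    ← Finset.mul_sum, ← Finset.mul_sum]
  ring
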